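/- Let $\mathbb U=\bigcup_{h\ge 0}\{1,2,\dots\}^h$ be the set of finite words over the positive integers. A plane tree is a non-empty finite set $T\subset\mathbb U$ such that, for all $u\in\mathbb U$ and $i\ge 1$, $ui\in T$ implies $u\in T$ and $uj\in T$ for $1\le j\le i$. For a plane tree $T$ and $u\in T$ let $k_u(T)$ be the number of $i\ge1$ with $ui\in T$; a leaf of $T$ is a vertex $u\in T$ with $k_u(T)=0$. We say that a plane tree $T'$ is obtained from $T$ by adding a right-leaning leaf if $T'=T\cup\{vi\}$ for some $v\in T$ with $i=k_v(T)+1$ (so that $vi\notin T$ and $vi$ is a leaf of $T'$). A non-negative sequence $(x_i)_{i\ge 0}$ is called log-concave if $x_i^2\ge x_{i-1}x_{i+1}$ for all $i\ge 1$ and it has no internal zeros, i.e. $x_ix_j\neq0$ with $i<j$ implies $x_k\ne 0$ for all $i\le k\le j$. For a non-negative sequence $w=(w_0,w_1,\dots)$ and $n\ge1$ such that some plane tree with $n$ vertices has non-zero weight, let $\mathbf{SG}_n^{w}$ be the probability distribution on plane trees with $n$ vertices which gives to each such tree $T$ a probability proportional to $\prod_{u\in T}w_{k_u(T)}$. For a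 probability measure $\mu$ on $\mathbb Z_+=\{0,1,2,\dots\}$, let $\mathbf{BGW}^\mu$ be the measure on plane trees with $\mathbf{BGW}^\mu(T)=\prod_{u\in T}\mu(k_u(T))$, and let $\mathbf{BGW}_n^\mu$ be the probability distribution obtained by conditioning it on $\{\#T=n\}$, whenever this event has non-zero mass. (1) Let $\mu$ be a probability measure on $\mathbb Z_+$ with $0<\mu(0)<1$ such that the sequence $(\mu(k))_{k\ge 0}$ is log-concave. Then the distributions $\mathbf{BGW}_n^\mu$, $n\ge1$, are well defined and can be coupled, on some probability space, as a Markov process $(T_n)_{n\ge1}$ such that $T_1\subset T_2\subset T_3\subset\cdots$, where for each $n\ge 1$ the tree $T_{n+1}$ is obtained from $T_n$ by adding a right-leaning leaf. (2) Let $w=(w_0,w_1,\dots)$ be a non-negative log-concave sequence with $w_0w_1>0$. Then the distributions $\mathbf{SG}_n^{w}$, $n\ge1$, are well defined and can be coupled, on some probability space, as a Markov process $(T_n)_{n\ge1}$ such that $T_1\subset T_2\subset T_3\subset\cdots$, where for each $n\ge 1$ the tree $T_{n+1}$ is obtained from $T_n$ by adding a right-leaning leaf. -/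

import Mathlib

open MeasureTheory

/-- Log-concavity of a (non-negative) sequence: `x (i-1) * x (i+1) ≤ x i ^ 2` for `i ≥ 1`, and no
internal zeros. -/
structure IsLogConcave (x : ℕ → ℝ) : Prop where
  mul_le_sq : ∀ i, x i * x (i + 2) ≤ x (i + 1) ^ 2
  no_internal_zeros : ∀ i j k, i ≤ k → k ≤ j → x i ≠ 0 → x j ≠ 0 → x k ≠ 0

/-- A plane tree in Neveu's formalism: a non-empty finite set of vertices of the Ulam–Harris tree
(finite words over `{1, 2, …}`), closed under taking parents and siblings to the left.
The vertex `u ++ [i]` is the `i`-th child of `u`. -/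
@[ext]
structure PlaneTree where
  verts : Finset (List ℕ+)
  nonempty : verts.Nonempty
  parent_mem : ∀ (u : List ℕ+) (i : ℕ+), u ++ [i] ∈ verts → u ∈ verts
  left_mem : ∀ (u : List ℕ+) (i j : ℕ+), u ++ [i] ∈ verts → j ≤ i → u ++ [j] ∈ verts

namespace PlaneTree

instance : MeasurableSpace PlaneTree := ⊤

/-- The number `k_u(T)` of children of `u` which are in `T`. -/
noncomputable def numChildren (T : PlaneTree) (u : List ℕ+) : ℕ :=
  {i : ℕ+ | u ++ [i] ∈ T.verts}.ncard

/-- A leaf of `T` is a vertex of `T` with no children in `T`. -/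
def IsLeaf (T : PlaneTree) (u : List ℕ+) : Prop :=
  u ∈ T.verts ∧ T.numChildren u = 0

/-- `T'` is obtained from `T` by adding one new leaf, which is right-leaning: it is the vertex
`vi` with `i = k_v(T) + 1`, for some vertex `v` of `T`. -/
def AddsRightLeaningLeaf (T T' : PlaneTree) : Prop :=
  ∃ v ∈ T.verts, ∃ i : ℕ+, (i : ℕ) = T.numChildren v + 1 ∧
    v ++ [i] ∉ T.verts ∧ T'.verts = insert (v ++ [i]) T.verts ∧ T'.IsLeaf (v ++ [i])

/-- The weight `∏_{u ∈ T} w (k_u(T))` of a plane tree. -/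
noncomputable def weight (w : ℕ → ℝ) (T : PlaneTree) : ℝ :=
  ∏ u ∈ T.verts, w (T.numChildren u)

/-- The measure on plane trees giving mass `weight w T` to each tree `T`, for a non-negative
sequence `w`. -/
noncomputable def weightMeasure (w : ℕ → ℝ) : Measure PlaneTree :=
  Measure.sum fun T => ENNReal.ofReal (weight w T) • Measure.dirac T

/-- The set of plane trees with `n` vertices. -/
def ofSize (n : ℕ) : Set PlaneTree := {T | T.verts.card = n}

/-- The law of the simply generated tree with `n` vertices: the measure `weightMeasure w`
restricted to trees with `n` vertices and normalised. -/
noncomputable def SG (w : ℕ → ℝ) (n : ℕ) : Measure PlaneTree :=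
  ProbabilityTheory.cond (weightMeasure w) (ofSize n)

/-- The Bienaymé–Galton–Watson measure with offspring distribution `μ`. -/
noncomputable def BGW (μ : Measure ℕ) : Measure PlaneTree :=
  weightMeasure fun k => μ.real {k}

/-- The Bienaymé–Galton–Watson measure conditioned on having `n` vertices. -/
noncomputable def condBGW (μ : Measure ℕ) (n : ℕ) : Measure PlaneTree :=
  ProbabilityTheory.cond (BGW μ) (ofSize n)

end PlaneTree

/-- The Markov property of a process `(X n)_{n ≥ 1}` with values in a countable discrete space:
given any possible past `X 1 = x 1, …, X n = x n`, the conditional law of `X (n+1)` is its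
conditional law given `X n = x n` alone. The value `X 0` plays no role. -/
def IsMarkovFromOne {Ω S : Type*} [MeasurableSpace Ω] (P : Measure Ω) (X : ℕ → Ω → S) : Prop :=
  ∀ n : ℕ, 1 ≤ n → ∀ (x : ℕ → S) (y : S),
    P {ω | ∀ i ∈ Finset.Icc 1 n, X i ω = x i} ≠ 0 →
    ProbabilityTheory.cond P {ω | ∀ i ∈ Finset.Icc 1 n, X i ω = x i} {ω | X (n + 1) ω = y} =
      ProbabilityTheory.cond P {ω | X n ω = x n} {ω | X (n + 1) ω = y}

/-- The laws `(L n)_{n ≥ 1}` on plane trees can be coupled, on some probability space, as a Markov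
process `T 1 ⊂ T 2 ⊂ T 3 ⊂ …` which adds one right-leaning leaf at each step. -/
def HasIncreasingMarkovCoupling (L : ℕ → Measure PlaneTree) : Prop :=
  ∃ (Ω : Type) (_ : MeasurableSpace Ω) (P : Measure Ω) (T : ℕ → Ω → PlaneTree),
    IsProbabilityMeasure P ∧
    (∀ n, 1 ≤ n → Measurable (T n) ∧ P.map (T n) = L n) ∧
    IsMarkovFromOne P T ∧
    (∀ ω n, 1 ≤ n → (T n ω).verts ⊂ (T (n + 1) ω).verts) ∧
    (∀ ω n, 1 ≤ n → (T n ω).AddsRightLeaningLeaf (T (n + 1) ω))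

/-! A plane tree with more than one vertex splits into the subtree of the first child of its root
and the remainder, that is, the root with its other children. Iterating this encodes plane trees by
binary trees. The remainder is again a tree, except that its root, having lost `j` children, has
weight `w (j + d)` when `d` children are left; all statements are therefore proved for every shift
`j`.

The coupling is recursive: to add a vertex, either the first subtree grows and the remainder is
kept, or the converse. This works as soon as the sizes of the first subtree, in trees of two
consecutive sizes, can be coupled with an increment 0 or 1. Equivalently, both the size of the first
subtree and that of the remainder are stochastically non-decreasing in the size of the tree
(`firstSubtree_interlace`, `remainder_interlace`, combined in `exists_firstSubtree_coupling`).
Gluing the flows of smaller trees then gives `exists_isGrowthFlow`.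

For the two monotonicities, explore the tree depth-first, visiting first the part of interest. That
part has more than `k` vertices when the Łukasiewicz walk has not exhausted it after `k` steps. A
larger total size pushes the position of the walk after `k` steps upwards in the likelihood ratio
order (`forestWeight_ratio_mono`), so it suffices that the probability of survival given this
position is non-decreasing in it (`forestPairing_ratio_mono`). For the remainder, survival means
staying above a fixed level, and convolution by a log-concave sequence preserves the likelihood
ratio order. For the first subtree the level is the random starting point of the walk, and Efron's
monotonicity is used at each step (`sum_mul_conv_le`, `survivalWeight_ratio_mono`).

Finally each tree independently receives a random successor distributed according to the flow;
following the successors from the one-vertex tree gives a Markov chain with the required marginals.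
-/

/-! ### Log-concavity, total positivity of order two and the likelihood ratio order. -/

/-- Two-row Cauchy–Binet inequality: if `a / b` and `g / f` are non-decreasing, then
`⟪a, f⟫ ⟪b, g⟫ ≤ ⟪a, g⟫ ⟪b, f⟫`. -/
theorem sum_mul_sum_le_of_ratio_mono (s : Finset ℕ) (a b f g : ℕ → ℝ)
    (hab : ∀ i j, i ≤ j → a i * b j ≤ a j * b i) (hfg : ∀ i j, i ≤ j → f j * g i ≤ f i * g j) :
    (∑ i ∈ s, a i * f i) * (∑ i ∈ s, b i * g i) ≤
      (∑ i ∈ s, a i * g i) * (∑ i ∈ s, b i * f i) := by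
  have h1 : (∑ i ∈ s, a i * g i) * (∑ i ∈ s, b i * f i) -
      (∑ i ∈ s, a i * f i) * (∑ i ∈ s, b i * g i) =
      ∑ i ∈ s, ∑ j ∈ s, a i * b j * (g i * f j - f i * g j) := by
    rw [Finset.sum_mul_sum, Finset.sum_mul_sum, ← Finset.sum_sub_distrib]
    refine Finset.sum_congr rfl fun i _ => ?_
    rw [← Finset.sum_sub_distrib]
    exact Finset.sum_congr rfl fun j _ => by ring
  have h2 : ∑ i ∈ s, ∑ j ∈ s, a i * b j * (g i * f j - f i * g j) =
      ∑ i ∈ s, ∑ j ∈ s, a j * b i * (g j * f i - f j * g i) := Finset.sum_comm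
  have h3 : 0 ≤ ∑ i ∈ s, ∑ j ∈ s, (a j * b i - a i * b j) * (f i * g j - f j * g i) := by
    refine Finset.sum_nonneg fun i _ => Finset.sum_nonneg fun j _ => ?_
    rcases le_total i j with h | h
    · exact mul_nonneg (sub_nonneg.2 (hab i j h)) (sub_nonneg.2 (hfg i j h))
    · exact mul_nonneg_of_nonpos_of_nonpos (sub_nonpos.2 (hab j i h)) (sub_nonpos.2 (hfg j i h))
  have h4 : ∑ i ∈ s, ∑ j ∈ s, (a j * b i - a i * b j) * (f i * g j - f j * g i) =
      (∑ i ∈ s, ∑ j ∈ s, a i * b j * (g i * f j - f i * g j)) +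
      ∑ i ∈ s, ∑ j ∈ s, a j * b i * (g j * f i - f j * g i) := by
    rw [← Finset.sum_add_distrib]
    refine Finset.sum_congr rfl fun i _ => ?_
    rw [← Finset.sum_add_distrib]
    exact Finset.sum_congr rfl fun j _ => by ring
  linarith

/-- A sequence all of whose Toeplitz `2 × 2` minors are non-negative. -/
def IsPF2 (x : ℕ → ℝ) : Prop :=
  ∀ p r s, x p * x (p + r + s) ≤ x (p + r) * x (p + s)

/-- The ratios of consecutive terms decrease along the support. To avoid divisions, the local
inequalities are multiplied together and the common factors cancelled; these are positive because
there are no internal zeros. -/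
theorem IsLogConcave.isPF2 {x : ℕ → ℝ} (hx : IsLogConcave x) (h0 : ∀ i, 0 ≤ x i) : IsPF2 x := by
  have step : ∀ s p, x p * x (p + s + 1) ≤ x (p + 1) * x (p + s) := by
    intro s
    induction s with
    | zero => intro p; simp [mul_comm]
    | succ s ih =>
      intro p
      have e : p + (s + 1) = p + s + 1 := by ring
      rw [e]
      by_cases hp : x p = 0
      · rw [hp, zero_mul]; exact mul_nonneg (h0 _) (h0 _)
      by_cases hq : x (p + s + 1 + 1) = 0
      · rw [hq, mul_zero]; exact mul_nonneg (h0 _) (h0 _)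
      have hr : 0 < x (p + s + 1) := lt_of_le_of_ne (h0 _)
        (hx.no_internal_zeros p (p + s + 1 + 1) _ (by omega) (by omega) hp hq).symm
      have ha := ih p
      have hb := hx.mul_le_sq (p + s)
      have e2 : p + s + 2 = p + s + 1 + 1 := rfl
      rw [e2] at hb
      by_cases hs : x (p + s) = 0
      · exact absurd hs (hx.no_internal_zeros p (p + s + 1 + 1) _ (by omega) (by omega) hp hq)
      have hs' : 0 < x (p + s) := lt_of_le_of_ne (h0 _) (Ne.symm hs)
      have h1 : (x p * x (p + s + 1 + 1)) * (x (p + s) * x (p + s + 1)) ≤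
          (x (p + 1) * x (p + s + 1)) * (x (p + s) * x (p + s + 1)) := by
        calc _ = (x p * x (p + s + 1)) * (x (p + s) * x (p + s + 1 + 1)) := by ring
          _ ≤ (x (p + 1) * x (p + s)) * (x (p + s + 1) ^ 2) :=
            mul_le_mul ha hb (mul_nonneg (h0 _) (h0 _)) (mul_nonneg (h0 _) (h0 _))
          _ = _ := by ring
      exact le_of_mul_le_mul_right h1 (mul_pos hs' hr)
  intro p r
  induction r with
  | zero => intro s; simp
  | succ r ih =>
    intro s
    have e : p + (r + 1) + s = p + r + s + 1 := by ring
    have e' : p + (r + 1) = p + r + 1 := by ring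
    rw [e, e']
    by_cases hp : x p = 0
    · rw [hp, zero_mul]; exact mul_nonneg (h0 _) (h0 _)
    by_cases hq : x (p + r + s + 1) = 0
    · rw [hq, mul_zero]; exact mul_nonneg (h0 _) (h0 _)
    have pos : ∀ k, p ≤ k → k ≤ p + r + s + 1 → 0 < x k := fun k h1 h2 =>
      lt_of_le_of_ne (h0 _) (hx.no_internal_zeros p _ k h1 h2 hp hq).symm
    have h1 : (x p * x (p + r + s + 1)) * (x (p + r) * x (p + r + s)) ≤
        (x (p + r + 1) * x (p + s)) * (x (p + r) * x (p + r + s)) := by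
      calc _ = (x p * x (p + r + s)) * (x (p + r) * x (p + r + s + 1)) := by ring
        _ ≤ (x (p + r) * x (p + s)) * (x (p + r + 1) * x (p + r + s)) :=
          mul_le_mul (ih s) (step s (p + r)) (mul_nonneg (h0 _) (h0 _))
            (mul_nonneg (h0 _) (h0 _))
        _ = _ := by ring
    exact le_of_mul_le_mul_right h1
      (mul_pos (pos _ (by omega) (by omega)) (pos _ (by omega) (by omega)))

/-- The Toeplitz kernel `w (s - z)`. -/
def toeplitz (w : ℕ → ℝ) (z s : ℕ) : ℝ := if z ≤ s then w (s - z) else 0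

theorem toeplitz_nonneg {w : ℕ → ℝ} (hw : ∀ i, 0 ≤ w i) (z s : ℕ) : 0 ≤ toeplitz w z s := by
  unfold toeplitz; split_ifs <;> simp [hw]

theorem toeplitz_of_lt (w : ℕ → ℝ) {z s : ℕ} (h : s < z) : toeplitz w z s = 0 := by
  simp [toeplitz, h]

theorem toeplitz_add (w : ℕ → ℝ) (z x : ℕ) : toeplitz w z (z + x) = w x := by
  simp [toeplitz]

theorem IsPF2.toeplitz_mul_le {w : ℕ → ℝ} (h : IsPF2 w) (hw : ∀ i, 0 ≤ w i) {z z' i j : ℕ}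
    (hz : z ≤ z') (hi : i ≤ j) :
    toeplitz w z' i * toeplitz w z j ≤ toeplitz w z i * toeplitz w z' j := by
  by_cases hzi : z' ≤ i
  · obtain ⟨p, rfl⟩ := Nat.exists_eq_add_of_le hzi
    obtain ⟨r, rfl⟩ := Nat.exists_eq_add_of_le hz
    obtain ⟨s, rfl⟩ := Nat.exists_eq_add_of_le hi
    have e1 : z + r + p + s = z + (p + r + s) := by ring
    have e2 : z + r + p = z + (p + r) := by ring
    have e3 : z + r + p + s = z + r + (p + s) := by ring
    have := h p r s
    rw [toeplitz_add, e1, toeplitz_add, ← e1, e3, toeplitz_add, e2, toeplitz_add]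
    exact this
  · rw [toeplitz_of_lt w (not_le.1 hzi), zero_mul]
    exact mul_nonneg (toeplitz_nonneg hw _ _) (toeplitz_nonneg hw _ _)

/-- The convolution of `V` and `w`. -/
def conv (w V : ℕ → ℝ) (s : ℕ) : ℝ := ∑ z ∈ Finset.range (s + 1), V z * toeplitz w z s

theorem conv_eq_sum_range (w V : ℕ → ℝ) {s M : ℕ} (h : s < M) :
    conv w V s = ∑ z ∈ Finset.range M, V z * toeplitz w z s := by
  refine Finset.sum_subset (Finset.range_mono h) fun z _ hz => ?_
  rw [toeplitz_of_lt w (by simpa using hz), mul_zero]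

theorem conv_nonneg {w V : ℕ → ℝ} (hw : ∀ i, 0 ≤ w i) (hV : ∀ i, 0 ≤ V i) (s : ℕ) :
    0 ≤ conv w V s :=
  Finset.sum_nonneg fun _ _ => mul_nonneg (hV _) (toeplitz_nonneg hw _ _)

theorem conv_eq_sum_sub (w V : ℕ → ℝ) (s : ℕ) :
    conv w V s = ∑ x ∈ Finset.range (s + 1), w x * V (s - x) := by
  rw [conv, ← Finset.sum_range_reflect]
  refine Finset.sum_congr rfl fun x hx => ?_
  have hx' : x ≤ s := by simpa [Nat.lt_succ_iff] using hx
  have : s + 1 - 1 - x = s - x := by omega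
  rw [this, toeplitz, if_pos (by omega), Nat.sub_sub_self hx', mul_comm]

/-- Convolution by a PF₂ sequence preserves the likelihood ratio order. -/
theorem conv_ratio_mono {w : ℕ → ℝ} (h : IsPF2 w) (hw : ∀ i, 0 ≤ w i) {a b : ℕ → ℝ}
    (hab : ∀ i j, i ≤ j → a i * b j ≤ a j * b i) {i j : ℕ} (hij : i ≤ j) :
    conv w a i * conv w b j ≤ conv w a j * conv w b i := by
  rw [conv_eq_sum_range w a (Nat.lt_succ_of_le hij), conv_eq_sum_range w b (Nat.lt_succ_of_le hij),
    conv, conv]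
  exact sum_mul_sum_le_of_ratio_mono _ a b _ _ hab fun z z' hz => h.toeplitz_mul_le hw hz hij

/-- The sequence `f` moved to the right by `r` places. -/
def delay (r : ℕ) (f : ℕ → ℝ) (y : ℕ) : ℝ := if r ≤ y then f (y - r) else 0

theorem conv_delay (w V : ℕ → ℝ) (r s : ℕ) : conv w (delay r V) (s + r) = conv w V s := by
  rw [conv_eq_sum_sub, conv_eq_sum_sub]
  symm
  refine Finset.sum_subset_zero_on_sdiff (Finset.range_mono (by omega)) ?_ ?_
  · intro x hx
    have : ¬ r ≤ s + r - x := by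
      simp only [Finset.mem_sdiff, Finset.mem_range] at hx; omega
    simp [delay, this]
  · intro x hx
    have hx' : x ≤ s := by simpa [Nat.lt_succ_iff] using hx
    have e : s + r - x - r = s - x := by omega
    rw [delay, if_pos (by omega), e]

/-- The PF₂ property of `V` says that every translate of `V` to the right dominates `V` in the
likelihood ratio order; convolution by `w` commutes with translations and preserves that order. -/
theorem IsPF2.conv {w V : ℕ → ℝ} (h : IsPF2 w) (hw : ∀ i, 0 ≤ w i) (hV : IsPF2 V)
    (hV0 : ∀ i, 0 ≤ V i) : IsPF2 (conv w V) := by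
  intro p r s
  have key : ∀ i j, i ≤ j → delay r V i * V j ≤ delay r V j * V i := by
    intro i j hij
    by_cases hr : r ≤ i
    · obtain ⟨q, rfl⟩ := Nat.exists_eq_add_of_le hr
      obtain ⟨t, rfl⟩ := Nat.exists_eq_add_of_le hij
      have := hV q r t
      have e1 : r + q + t - r = q + t := by omega
      rw [delay, delay, if_pos hr, if_pos (by omega), e1, Nat.add_sub_cancel_left]
      rw [add_comm r q, mul_comm (V (q + t))]
      exact this
    · rw [delay, if_neg hr, zero_mul]
      refine mul_nonneg ?_ (hV0 _)
      unfold delay; split_ifs <;> simp [hV0]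
  have := conv_ratio_mono h hw key (show p + r ≤ p + s + r by omega)
  rw [conv_delay, conv_delay] at this
  have e : p + r + s = p + s + r := by ring
  rw [e, mul_comm (_root_.conv w V (p + r))]
  exact this

/-! ### Couplings of integer laws which stay put or move by one. -/

/-- Two non-negative sequences whose normalisations `p'`, `p` have interlacing distribution
functions can be coupled so as to stay put or move by one. -/
theorem exists_stay_move (p p' : ℕ → ℝ) (N : ℕ)
    (hA : ∀ k ≤ N, (∑ l ∈ Finset.Ico k N, p l) * (∑ l ∈ Finset.range (N + 1), p' l) ≤
      (∑ l ∈ Finset.Ico k (N + 1), p' l) * (∑ l ∈ Finset.range N, p l))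
    (hB : ∀ k ≤ N, (∑ l ∈ Finset.range k, p l) * (∑ l ∈ Finset.range (N + 1), p' l) ≤
      (∑ l ∈ Finset.range (k + 1), p' l) * (∑ l ∈ Finset.range N, p l)) :
    ∃ stay move : ℕ → ℝ, (∀ l ≤ N, 0 ≤ stay l) ∧ (∀ l < N, 0 ≤ move l) ∧ stay N = 0 ∧
      (∀ l < N, stay l + move l = p l * ∑ l ∈ Finset.range (N + 1), p' l) ∧
      stay 0 = p' 0 * (∑ l ∈ Finset.range N, p l) ∧
      (∀ l < N, stay (l + 1) + move l = p' (l + 1) * ∑ l ∈ Finset.range N, p l) := by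
  set P := ∑ l ∈ Finset.range N, p l with hP
  set P' := ∑ l ∈ Finset.range (N + 1), p' l with hP'
  -- Conservation of mass, solved upwards from `l = 0`, forces these differences of partial sums.
  -- Then `hB` is non-negativity of `stay` and `hA` that of `move`.
  refine ⟨fun l => (∑ i ∈ Finset.range (l + 1), p' i) * P - (∑ i ∈ Finset.range l, p i) * P',
    fun l => (∑ i ∈ Finset.range (l + 1), p i) * P' - (∑ i ∈ Finset.range (l + 1), p' i) * P,
    fun l hl => sub_nonneg.2 (hB l hl), fun l hl => ?_, ?_, fun l _ => ?_, ?_, fun l _ => ?_⟩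
  · have h := hA (l + 1) hl
    have h1 := Finset.sum_range_add_sum_Ico p (show l + 1 ≤ N by omega)
    have h2 := Finset.sum_range_add_sum_Ico p' (show l + 1 ≤ N + 1 by omega)
    have e1 : ∑ i ∈ Finset.range (l + 1), p i = P - ∑ l ∈ Finset.Ico (l + 1) N, p l := by
      rw [hP]; linarith
    have e2 : ∑ i ∈ Finset.range (l + 1), p' i = P' - ∑ l ∈ Finset.Ico (l + 1) (N + 1), p' l := by
      rw [hP']; linarith
    simp only [e1, e2]; nlinarith
  · simp only [← hP, ← hP']; ring
  · simp only [Finset.sum_range_succ p l]; ring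
  · simp
  · simp only [Finset.sum_range_succ p' (l + 1)]; ring

/-- The mean of `F` under `p` is at most that of `F'` under `p'`, by integrating the pointwise
bounds over the coupling. -/
theorem sum_mul_le_of_stay_move {p p' F F' : ℕ → ℝ} {N : ℕ} {P P' : ℝ} {stay move : ℕ → ℝ}
    (hs : ∀ l ≤ N, 0 ≤ stay l) (hm : ∀ l < N, 0 ≤ move l) (hN : stay N = 0)
    (h : ∀ l < N, stay l + move l = p l * P') (h0 : stay 0 = p' 0 * P)
    (h' : ∀ l < N, stay (l + 1) + move l = p' (l + 1) * P)
    (hF : ∀ l < N, F l ≤ F' l) (hF' : ∀ l < N, F l ≤ F' (l + 1)) :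
    (∑ l ∈ Finset.range N, p l * F l) * P' ≤ (∑ l ∈ Finset.range (N + 1), p' l * F' l) * P := by
  have e : (∑ l ∈ Finset.range (N + 1), p' l * F' l) * P =
      ∑ l ∈ Finset.range N, (stay l * F' l + move l * F' (l + 1)) := by
    have h1 : ∑ l ∈ Finset.range N, stay l * F' l = ∑ l ∈ Finset.range (N + 1), stay l * F' l := by
      rw [Finset.sum_range_succ, hN]; simp
    rw [Finset.sum_add_distrib, h1, Finset.sum_range_succ', Finset.sum_range_succ', add_mul,
      add_right_comm, ← Finset.sum_add_distrib, Finset.sum_mul, h0]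
    congr 1
    · refine Finset.sum_congr rfl fun l hl => ?_
      rw [← add_mul, h' l (Finset.mem_range.1 hl)]; ring
    · ring
  rw [e, Finset.sum_mul]
  refine Finset.sum_le_sum fun l hl => ?_
  have hl := Finset.mem_range.1 hl
  have e2 : p l * F l * P' = stay l * F l + move l * F l := by rw [← add_mul, h l hl]; ring
  rw [e2]
  exact add_le_add (mul_le_mul_of_nonneg_left (hF l hl) (hs l hl.le))
    (mul_le_mul_of_nonneg_left (hF' l hl) (hm l hl))

/-! ### Weights of forests and trees, and the Łukasiewicz walk. -/

/-- The total weight of the plane forests with `d` trees and `t` vertices. -/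
def forestWeight (w : ℕ → ℝ) : ℕ → ℕ → ℝ
  | 0, 0 => 1
  | 0, _ + 1 => 0
  | _ + 1, 0 => 0
  | t + 1, d + 1 => ∑ x ∈ Finset.range (t + 1), w x * forestWeight w t (d + x)

section forestWeight

variable (w : ℕ → ℝ)

theorem forestWeight_succ_zero (t : ℕ) : forestWeight w (t + 1) 0 = 0 := by simp [forestWeight]

theorem forestWeight_zero_succ (d : ℕ) : forestWeight w 0 (d + 1) = 0 := by simp [forestWeight]

theorem forestWeight_nonneg (hw : ∀ i, 0 ≤ w i) : ∀ t d, 0 ≤ forestWeight w t d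
  | 0, 0 => by simp [forestWeight]
  | 0, _ + 1 => by simp [forestWeight]
  | _ + 1, 0 => by simp [forestWeight]
  | t + 1, d + 1 => by
    rw [forestWeight]
    exact Finset.sum_nonneg fun x _ => mul_nonneg (hw x) (forestWeight_nonneg hw t _)

theorem forestWeight_of_lt : ∀ {t d : ℕ}, t < d → forestWeight w t d = 0
  | 0, 0, h => absurd h (lt_irrefl _)
  | 0, _ + 1, _ => by simp [forestWeight]
  | _ + 1, 0, h => by omega
  | t + 1, d + 1, h => by
    rw [forestWeight]
    refine Finset.sum_eq_zero fun x _ => ?_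
    rw [forestWeight_of_lt (show t < d + x by omega), mul_zero]

theorem forestWeight_succ_succ {t M : ℕ} (h : t < M) (d : ℕ) :
    forestWeight w (t + 1) (d + 1) = ∑ x ∈ Finset.range M, w x * forestWeight w t (d + x) := by
  rw [forestWeight]
  refine Finset.sum_subset (Finset.range_mono h) fun x _ hx => ?_
  rw [forestWeight_of_lt w (by simp at hx; omega), mul_zero]

/-- Here `m` is the number of vertices of the first `p` trees. The induction removes the root of the
first tree, whose children then become roots. -/
theorem forestWeight_add (t : ℕ) : ∀ p q, forestWeight w t (p + q) =
    ∑ m ∈ Finset.range (t + 1), forestWeight w m p * forestWeight w (t - m) q := by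
  induction t with
  | zero =>
    rintro (_ | p) q
    · simp [forestWeight]
    · rw [show p + 1 + q = p + q + 1 by ring]; simp [forestWeight]
  | succ t ih =>
    rintro (_ | p) q
    · rw [Finset.sum_range_succ', Finset.sum_eq_zero fun m _ => by
        rw [forestWeight_succ_zero, zero_mul]]
      simp [forestWeight]
    · rw [show p + 1 + q = p + q + 1 by ring, Finset.sum_range_succ', forestWeight_zero_succ,
        zero_mul, add_zero, forestWeight]
      have h1 : ∀ x, forestWeight w t (p + q + x) =
          ∑ m ∈ Finset.range (t + 1), forestWeight w m (p + x) * forestWeight w (t - m) q := by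
        intro x; rw [show p + q + x = p + x + q by ring]; exact ih _ _
      simp only [h1, Finset.mul_sum]
      rw [Finset.sum_comm]
      refine Finset.sum_congr rfl fun m hm => ?_
      rw [forestWeight_succ_succ w (Finset.mem_range.1 hm), Finset.sum_mul,
        Nat.add_sub_add_right]
      exact Finset.sum_congr rfl fun x _ => by ring

/-- The sum is over the number `y + 1` of trees left after the first root is removed; it is positive
because `t ≥ 1` vertices remain. -/
theorem forestWeight_succ_succ_toeplitz {t : ℕ} (ht : 1 ≤ t) (z : ℕ) :
    forestWeight w (t + 1) (z + 1) =
      ∑ y ∈ Finset.range t, toeplitz w z (y + 1) * forestWeight w t (y + 1) := by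
  have h0 : forestWeight w t 0 = 0 := by
    obtain ⟨s, rfl⟩ := Nat.exists_eq_add_of_le' ht; exact forestWeight_succ_zero w s
  have h1 : ∑ y ∈ Finset.range t, toeplitz w z (y + 1) * forestWeight w t (y + 1) =
      ∑ y ∈ Finset.range (t + 1), toeplitz w z y * forestWeight w t y := by
    rw [Finset.sum_range_succ', h0]; simp
  have h2 : ∑ y ∈ Finset.range (t + 1), toeplitz w z y * forestWeight w t y =
      ∑ y ∈ Finset.range (z + (t + 1)), toeplitz w z y * forestWeight w t y := by
    refine Finset.sum_subset (Finset.range_mono (by omega)) fun y _ hy => ?_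
    rw [forestWeight_of_lt w (by simp at hy; omega), mul_zero]
  rw [h1, h2, Finset.sum_range_add, Finset.sum_eq_zero (s := Finset.range z), zero_add,
    forestWeight]
  · simp only [toeplitz_add]
  · intro y hy
    rw [toeplitz_of_lt w (Finset.mem_range.1 hy), zero_mul]

/-- The total weight of the trees with `N` vertices besides the root, the root having weight
`w (j + d)` if it has `d` children. -/
def treeWeight (j N : ℕ) : ℝ := ∑ d ∈ Finset.range (N + 1), w (j + d) * forestWeight w N d

theorem treeWeight_nonneg (hw : ∀ i, 0 ≤ w i) (j N : ℕ) : 0 ≤ treeWeight w j N :=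
  Finset.sum_nonneg fun _ _ => mul_nonneg (hw _) (forestWeight_nonneg w hw _ _)

theorem treeWeight_eq_sum_range {N M : ℕ} (h : N < M) (j : ℕ) :
    treeWeight w j N = ∑ d ∈ Finset.range M, w (j + d) * forestWeight w N d := by
  refine Finset.sum_subset (Finset.range_mono h) fun x _ hx => ?_
  rw [forestWeight_of_lt w (by simp at hx; omega), mul_zero]

theorem treeWeight_zero (j : ℕ) : treeWeight w j 0 = w j := by
  simp [treeWeight, forestWeight]

theorem forestWeight_succ_one (N : ℕ) : forestWeight w (N + 1) 1 = treeWeight w 0 N := by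
  simp [forestWeight, treeWeight]

/-- Decomposition at the first child of the root: the shift `j + 1` records that this child has been
removed. -/
theorem treeWeight_succ (j N : ℕ) : treeWeight w j (N + 1) =
    ∑ l ∈ Finset.range (N + 1), treeWeight w 0 l * treeWeight w (j + 1) (N - l) := by
  rw [treeWeight, Finset.sum_range_succ', forestWeight_succ_zero, mul_zero, add_zero]
  have h : ∀ d, forestWeight w (N + 1) (d + 1) =
      ∑ l ∈ Finset.range (N + 1), treeWeight w 0 l * forestWeight w (N - l) d := by
    intro d
    rw [add_comm d 1, forestWeight_add, Finset.sum_range_succ', forestWeight_zero_succ, zero_mul,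
      add_zero]
    refine Finset.sum_congr rfl fun l _ => ?_
    rw [forestWeight_succ_one, Nat.add_sub_add_right]
  simp only [h, Finset.mul_sum]
  rw [Finset.sum_comm]
  refine Finset.sum_congr rfl fun l hl => ?_
  rw [treeWeight_eq_sum_range w (show N - l < N + 1 by omega), Finset.mul_sum]
  refine Finset.sum_congr rfl fun d _ => ?_
  rw [show j + (d + 1) = j + 1 + d by ring]; ring

/-- The pairing of a sequence `V` with the weights of the non-empty forests with `t` vertices. -/
def forestPairing (V : ℕ → ℝ) (t : ℕ) : ℝ :=
  ∑ y ∈ Finset.range t, V y * forestWeight w t (y + 1)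

theorem forestPairing_eq_sum_range {t M : ℕ} (h : t ≤ M) (V : ℕ → ℝ) :
    forestPairing w V t = ∑ y ∈ Finset.range M, V y * forestWeight w t (y + 1) := by
  refine Finset.sum_subset (Finset.range_mono h) fun x _ hx => ?_
  rw [forestWeight_of_lt w (by simp at hx; omega), mul_zero]

theorem forestPairing_weight (j N : ℕ) :
    forestPairing w (fun y => w (j + 1 + y)) (N + 1) = treeWeight w j (N + 1) := by
  rw [treeWeight, Finset.sum_range_succ', forestWeight_succ_zero, mul_zero, add_zero,
    forestPairing]
  exact Finset.sum_congr rfl fun y _ => by rw [show j + 1 + y = j + (y + 1) by ring]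

/-- One step of the Łukasiewicz walk killed below `0`, acting on weights. -/
def walkStep (V : ℕ → ℝ) (y : ℕ) : ℝ := conv w V (y + 1)

/-- Duality: the forward step of the walk is adjoint to the backward recursion for the weight of
completing the forest. Position `y` of the walk stands for `y + 1` unexplored trees. -/
theorem forestPairing_walkStep (V : ℕ → ℝ) {t : ℕ} (ht : 1 ≤ t) :
    forestPairing w (walkStep w V) t = forestPairing w V (t + 1) := by
  have h1 : ∀ y ∈ Finset.range t, walkStep w V y * forestWeight w t (y + 1) =
      ∑ z ∈ Finset.range (t + 1), V z * toeplitz w z (y + 1) * forestWeight w t (y + 1) := by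
    intro y hy
    rw [walkStep, conv_eq_sum_range w V (M := t + 1) (by simp at hy; omega), Finset.sum_mul]
  rw [forestPairing, Finset.sum_congr rfl h1, Finset.sum_comm]
  refine Finset.sum_congr rfl fun z _ => ?_
  rw [forestWeight_succ_succ_toeplitz w ht, Finset.mul_sum]
  exact Finset.sum_congr rfl fun y _ => by ring

theorem forestPairing_walkStep_iterate (V : ℕ → ℝ) {t : ℕ} (ht : 1 ≤ t) (k : ℕ) :
    forestPairing w ((walkStep w)^[k] V) t = forestPairing w V (t + k) := by
  induction k generalizing t with
  | zero => rfl
  | succ k ih =>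
    rw [Function.iterate_succ_apply', forestPairing_walkStep w _ ht, ih (by omega)]
    congr 1; omega

variable {w}

/-- The likelihood ratio order of the number of trees of a forest in its number of vertices. -/
theorem forestWeight_ratio_mono (hp : IsPF2 w) (hw : ∀ i, 0 ≤ w i) (t : ℕ) :
    ∀ y y', y ≤ y' → forestWeight w (t + 1) (y' + 1) * forestWeight w (t + 2) (y + 1) ≤
      forestWeight w (t + 1) (y + 1) * forestWeight w (t + 2) (y' + 1) := by
  induction t with
  | zero =>
    -- A single vertex makes a forest of one tree only, so the left side vanishes unless `y' = 0`.
    rintro y (_ | y') h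
    · obtain rfl : y = 0 := by omega
      exact le_rfl
    · rw [forestWeight_of_lt w (show 0 + 1 < y' + 1 + 1 by omega), zero_mul]
      exact mul_nonneg (forestWeight_nonneg w hw _ _) (forestWeight_nonneg w hw _ _)
  | succ t ih =>
    intro z z' h
    have e : ∀ z, forestWeight w (t + 1 + 1) (z + 1) = ∑ y ∈ Finset.range (t + 2),
        toeplitz w z (y + 1) * forestWeight w (t + 1) (y + 1) := by
      intro z
      rw [forestWeight_succ_succ_toeplitz w (by omega)]
      refine Finset.sum_subset (Finset.range_mono (by omega)) fun x _ hx => ?_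
      rw [forestWeight_of_lt w (by simp at hx; omega), mul_zero]
    rw [show t + 1 + 2 = t + 2 + 1 by ring, forestWeight_succ_succ_toeplitz w (t := t + 2) (by omega),
      forestWeight_succ_succ_toeplitz w (t := t + 2) (by omega), e, e]
    have := sum_mul_sum_le_of_ratio_mono (Finset.range (t + 2)) (fun y => toeplitz w z' (y + 1))
      (fun y => toeplitz w z (y + 1)) (fun y => forestWeight w (t + 1) (y + 1))
      (fun y => forestWeight w (t + 2) (y + 1))
      (fun i j hij => (hp.toeplitz_mul_le hw h (show i + 1 ≤ j + 1 by omega)).trans_eq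
        (mul_comm _ _)) ih
    exact this.trans_eq (mul_comm _ _)

/-- With `b` the weight of all walks and `a` that of the surviving ones, this says that survival
becomes more likely when more vertices remain. -/
theorem forestPairing_ratio_mono (hp : IsPF2 w) (hw : ∀ i, 0 ≤ w i) {a b : ℕ → ℝ}
    (hab : ∀ i j, i ≤ j → a i * b j ≤ a j * b i) {t : ℕ} (ht : 1 ≤ t) :
    forestPairing w a t * forestPairing w b (t + 1) ≤
      forestPairing w a (t + 1) * forestPairing w b t := by
  obtain ⟨t, rfl⟩ := Nat.exists_eq_add_of_le' ht
  rw [forestPairing_eq_sum_range w (Nat.le_succ (t + 1)) a,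
    forestPairing_eq_sum_range w (Nat.le_succ (t + 1)) b]
  exact sum_mul_sum_le_of_ratio_mono _ a b _ _ hab (forestWeight_ratio_mono hp hw t)

/-! ### Monotonicity of the size of the remainder of the tree -/

theorem walkStep_delay_succ (V : ℕ → ℝ) (y : ℕ) :
    walkStep w (delay 1 V) (y + 1) = walkStep w V y := conv_delay w V 1 (y + 1)

/-- Away from `0`, the left-hand walk makes the same step as the other one. At `0` it is killed,
which only removes mass at the bottom and so keeps the order. -/
theorem delay_walkStep_ratio_mono (hp : IsPF2 w) (hw : ∀ i, 0 ≤ w i) {u u' : ℕ → ℝ}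
    (hu : ∀ i, 0 ≤ u i) (hu' : ∀ i, 0 ≤ u' i)
    (h : ∀ i j, i ≤ j → delay 1 u' i * u j ≤ delay 1 u' j * u i) {i j : ℕ} (hij : i ≤ j) :
    delay 1 (walkStep w u') i * walkStep w u j ≤ delay 1 (walkStep w u') j * walkStep w u i := by
  have e : ∀ y, delay 1 (walkStep w u') (y + 1) = walkStep w (delay 1 u') (y + 1) := by
    intro y; rw [walkStep_delay_succ]; simp [delay]
  rcases i with _ | i
  · have : delay 1 (walkStep w u') 0 = 0 := by simp [delay]
    rw [this, zero_mul]
    refine mul_nonneg ?_ (conv_nonneg hw hu _)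
    unfold delay; split_ifs
    exacts [conv_nonneg hw hu' _, le_rfl]
  · obtain ⟨j, rfl⟩ := Nat.exists_eq_add_of_le' (show 1 ≤ j by omega)
    rw [e, e]
    exact conv_ratio_mono hp hw h (by omega)

theorem walkStep_iterate_nonneg (hw : ∀ i, 0 ≤ w i) {u : ℕ → ℝ} (hu : ∀ i, 0 ≤ u i) (k : ℕ) :
    ∀ i, 0 ≤ (walkStep w)^[k] u i := by
  induction k with
  | zero => exact hu
  | succ k ih =>
    intro i; rw [Function.iterate_succ_apply']; exact conv_nonneg hw ih _

/-- The delayed sequence is the walk killed one level higher. Initially it is `u` with its value at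
`0` removed, and the order then propagates. -/
theorem delay_walkStep_iterate_ratio_mono (hp : IsPF2 w) (hw : ∀ i, 0 ≤ w i) {u : ℕ → ℝ}
    (hu : ∀ i, 0 ≤ u i) (k : ℕ) : ∀ i j, i ≤ j →
    delay 1 ((walkStep w)^[k] fun y => u (y + 1)) i * (walkStep w)^[k] u j ≤
      delay 1 ((walkStep w)^[k] fun y => u (y + 1)) j * (walkStep w)^[k] u i := by
  induction k with
  | zero =>
    have e : ∀ y, delay 1 (fun y => u (y + 1)) (y + 1) = u (y + 1) := by intro y; simp [delay]
    rintro (_ | i) j hij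
    · have : delay 1 (fun y => u (y + 1)) 0 = 0 := by simp [delay]
      simp only [Function.iterate_zero, id, this, zero_mul]
      refine mul_nonneg ?_ (hu _)
      unfold delay; split_ifs
      exacts [hu _, le_rfl]
    · obtain ⟨j, rfl⟩ := Nat.exists_eq_add_of_le' (show 1 ≤ j by omega)
      simp only [Function.iterate_zero, id, e]
      exact (mul_comm _ _).le
  | succ k ih =>
    intro i j hij
    simp only [Function.iterate_succ_apply']
    exact delay_walkStep_ratio_mono hp hw (walkStep_iterate_nonneg hw hu k)
      (walkStep_iterate_nonneg hw (fun i => hu (i + 1)) k) ih hij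

/-- The remainder is explored first and the first subtree is kept for last, as the extra tree added
by `delay 1`. After `k` steps the remainder still has unexplored trees: these use `t - l ≥ 1` of the
last `t + 1` vertices and the first subtree the other `l + 1`. -/
theorem forestPairing_delay_walkStep_iterate (j k t : ℕ) :
    forestPairing w (delay 1 ((walkStep w)^[k] fun y => w (j + 1 + (y + 1)))) (t + 1) =
      ∑ l ∈ Finset.range t, treeWeight w 0 l * treeWeight w (j + 1) (t + k - l) := by
  set β := (walkStep w)^[k] fun y => w (j + 1 + (y + 1)) with hβ
  have e : ∀ y, delay 1 β (y + 1) = β y := by intro y; simp [delay]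
  have e0 : delay 1 β 0 = 0 := by simp [delay]
  rw [forestPairing, Finset.sum_range_succ', e0, zero_mul, add_zero]
  have h : ∀ y, forestWeight w (t + 1) (y + 1 + 1) =
      ∑ l ∈ Finset.range t, treeWeight w 0 l * forestWeight w (t - l) (y + 1) := by
    intro y
    rw [add_comm (y + 1) 1, forestWeight_add, Finset.sum_range_succ', forestWeight_zero_succ,
      zero_mul, add_zero, Finset.sum_range_succ, Nat.sub_self, forestWeight_zero_succ, mul_zero,
      add_zero]
    refine Finset.sum_congr rfl fun l _ => ?_
    rw [forestWeight_succ_one, Nat.add_sub_add_right]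
  simp only [h, Finset.mul_sum, e]
  rw [Finset.sum_comm]
  refine Finset.sum_congr rfl fun l hl => ?_
  have hl := Finset.mem_range.1 hl
  have h2 : forestPairing w β (t - l) = treeWeight w (j + 1) (t + k - l) := by
    rw [hβ, forestPairing_walkStep_iterate w _ (by omega)]
    obtain ⟨m, hm⟩ := Nat.exists_eq_add_of_le' (show 1 ≤ t + k - l by omega)
    rw [show t - l + k = m + 1 by omega, hm, ← forestPairing_weight]
    congr 1; funext y; congr 1; ring
  rw [← h2, forestPairing_eq_sum_range w (show t - l ≤ t by omega), Finset.mul_sum]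
  exact Finset.sum_congr rfl fun d _ => by ring

/-- The event `l < k` means that the remainder outlives `N - k` steps of its exploration. -/
theorem remainder_interlace (hp : IsPF2 w) (hw : ∀ i, 0 ≤ w i) (j N k : ℕ) (hk : k ≤ N) :
    (∑ l ∈ Finset.range k, treeWeight w 0 l * treeWeight w (j + 1) (N - l)) *
        treeWeight w j (N + 2) ≤
      (∑ l ∈ Finset.range (k + 1), treeWeight w 0 l * treeWeight w (j + 1) (N + 1 - l)) *
        treeWeight w j (N + 1) := by
  have h := forestPairing_ratio_mono hp hw
    (delay_walkStep_iterate_ratio_mono hp hw (fun i => hw (j + 1 + i)) (N - k))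
    (show 1 ≤ k + 1 by omega)
  rw [forestPairing_walkStep_iterate w _ (by omega), forestPairing_walkStep_iterate w _ (by omega),
    forestPairing_delay_walkStep_iterate, forestPairing_delay_walkStep_iterate,
    show k + 1 + 1 + (N - k) = N + 1 + 1 by omega, show k + 1 + (N - k) = N + 1 by omega,
    forestPairing_weight, forestPairing_weight] at h
  rw [show k + (N - k) = N by omega] at h
  exact h
end forestWeight

/-! ### Monotonicity of the size of the first subtree. -/

section survival

/-- The weight of the killed Łukasiewicz walks with initial weight `u` which are at `y` after `k`
steps, have stayed above their starting point and are at distance at least `c` above it. -/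
def survivalWeight (w u : ℕ → ℝ) : ℕ → ℕ → ℕ → ℝ
  | 0, y, c => if c = 0 then u y else 0
  | k + 1, y, c => ∑ x ∈ Finset.range (y + 2), w x * survivalWeight w u k (y + 1 - x) (c + 1 - x)

/-- Relative to its starting point `y - r`, a surviving path is a walk from `0` killed below `0` and
ending at `r`. -/
theorem survivalWeight_eq_sum (w u : ℕ → ℝ) (k : ℕ) : ∀ y c, survivalWeight w u k y c =
    ∑ r ∈ Finset.Ico c (y + 1),
      u (y - r) * (walkStep w)^[k] (fun r => if r = 0 then 1 else 0) r := by
  induction k with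
  | zero =>
    intro y c
    rcases c with _ | c
    · rw [Finset.sum_eq_single 0] <;> simp +contextual [survivalWeight]
    · rw [Finset.sum_eq_zero]
      · simp [survivalWeight]
      · intro r hr
        have : r ≠ 0 := by simp at hr; omega
        simp [this]
  | succ k ih =>
    intro y c
    set g := (walkStep w)^[k] (fun r => if r = 0 then 1 else 0) with hg
    rw [Function.iterate_succ_apply', ← hg, survivalWeight]
    have h1 : ∀ x ∈ Finset.range (y + 2), w x * survivalWeight w u k (y + 1 - x) (c + 1 - x) =
        ∑ s ∈ Finset.Ico (c + 1) (y + 1 + 1),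
          u (y + 1 - s) * (if x ≤ s then w x * g (s - x) else 0) := by
      intro x hx
      have hx := Finset.mem_range.1 hx
      simp only [mul_ite, mul_zero]
      rw [ih, Finset.mul_sum, ← Finset.sum_filter]
      refine Finset.sum_nbij' (· + x) (· - x) ?_ ?_ ?_ ?_ ?_
      · intro r hr; simp at hr ⊢; omega
      · intro r hr; simp at hr ⊢; omega
      · intro r hr; simp
      · intro r hr; simp at hr ⊢; omega
      · intro r hr
        rw [show y + 1 - (r + x) = y + 1 - x - r by omega, Nat.add_sub_cancel]; ring
    rw [Finset.sum_congr rfl h1, Finset.sum_comm, ← Finset.sum_Ico_add']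
    refine Finset.sum_congr rfl fun r hr => ?_
    have hr : r < y + 1 := (Finset.mem_Ico.1 hr).2
    rw [← Finset.mul_sum, Nat.add_sub_add_right, walkStep, conv_eq_sum_sub]
    congr 1
    symm
    refine Finset.sum_subset_zero_on_sdiff (Finset.range_mono (by omega)) ?_ ?_
    · intro x hx
      rw [if_neg]
      simp at hx; omega
    · intro x hx
      rw [if_pos]
      simp at hx; omega

variable {w : ℕ → ℝ}

/-- The first subtree is explored first. After `k` steps it has `r + 1` unexplored trees, and its
siblings root `z` more; the last `t + 1` vertices split into `l + 1` that complete the first subtree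
and `t - l` for the siblings. -/
theorem forestPairing_survivalWeight (j k t : ℕ) :
    forestPairing w (fun y => survivalWeight w (fun y => w (j + 1 + y)) k y 0) (t + 1) =
      ∑ l ∈ Finset.range (t + 1), treeWeight w 0 (k + l) * treeWeight w (j + 1) (t - l) := by
  set g := (walkStep w)^[k] (fun r => if r = 0 then 1 else 0) with hg
  have h1 : ∀ y ∈ Finset.range (t + 1),
      survivalWeight w (fun y => w (j + 1 + y)) k y 0 * forestWeight w (t + 1) (y + 1) =
      ∑ z ∈ Finset.range (t + 1),
        w (j + 1 + z) * (toeplitz g z y * forestWeight w (t + 1) (y + 1)) := by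
    intro y hy
    have : survivalWeight w (fun y => w (j + 1 + y)) k y 0 = conv g (fun y => w (j + 1 + y)) y := by
      rw [survivalWeight_eq_sum, conv_eq_sum_sub, Finset.range_eq_Ico]
      exact Finset.sum_congr rfl fun r _ => mul_comm _ _
    rw [this, conv_eq_sum_range _ _ (Finset.mem_range.1 hy), Finset.sum_mul]
    exact Finset.sum_congr rfl fun z _ => by ring
  have h2 : ∀ z, ∑ y ∈ Finset.range (t + 1), toeplitz g z y * forestWeight w (t + 1) (y + 1) =
      ∑ r ∈ Finset.range (t + 1), g r * forestWeight w (t + 1) (r + 1 + z) := by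
    intro z
    have e : ∑ y ∈ Finset.range (t + 1), toeplitz g z y * forestWeight w (t + 1) (y + 1) =
        ∑ y ∈ Finset.range (z + (t + 1)), toeplitz g z y * forestWeight w (t + 1) (y + 1) := by
      refine Finset.sum_subset (Finset.range_mono (by omega)) fun y _ hy => ?_
      rw [forestWeight_of_lt w (by simp at hy; omega), mul_zero]
    rw [e, Finset.sum_range_add, Finset.sum_eq_zero (s := Finset.range z), zero_add]
    · refine Finset.sum_congr rfl fun r _ => ?_
      rw [toeplitz_add, show z + r + 1 = r + 1 + z by ring]
    · intro y hy
      rw [toeplitz_of_lt g (Finset.mem_range.1 hy), zero_mul]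
  have h3 : ∀ r z, forestWeight w (t + 1) (r + 1 + z) =
      ∑ l ∈ Finset.range (t + 1), forestWeight w (l + 1) (r + 1) * forestWeight w (t - l) z := by
    intro r z
    rw [forestWeight_add, Finset.sum_range_succ', forestWeight_zero_succ, zero_mul, add_zero]
    exact Finset.sum_congr rfl fun l _ => by rw [Nat.add_sub_add_right]
  have h4 : ∀ l ∈ Finset.range (t + 1),
      ∑ r ∈ Finset.range (t + 1), g r * forestWeight w (l + 1) (r + 1) = treeWeight w 0 (k + l) := by
    intro l hl
    rw [← forestPairing_eq_sum_range w (by simp at hl; omega), hg,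
      forestPairing_walkStep_iterate w _ (by omega), forestPairing,
      Finset.sum_eq_single 0 (by simp +contextual) (by simp)]
    rw [show l + 1 + k = k + l + 1 by ring, zero_add, forestWeight_succ_one]
    simp
  rw [forestPairing, Finset.sum_congr rfl h1, Finset.sum_comm]
  simp only [← Finset.mul_sum, h2, h3]
  have h5 : ∀ l ∈ Finset.range (t + 1), treeWeight w 0 (k + l) * treeWeight w (j + 1) (t - l) =
      ∑ z ∈ Finset.range (t + 1), ∑ r ∈ Finset.range (t + 1), w (j + 1 + z) *
        (g r * (forestWeight w (l + 1) (r + 1) * forestWeight w (t - l) z)) := by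
    intro l hl
    rw [← h4 l hl, treeWeight_eq_sum_range w (show t - l < t + 1 by omega), Finset.sum_mul_sum,
      Finset.sum_comm]
    exact Finset.sum_congr rfl fun z _ => Finset.sum_congr rfl fun r _ => by ring
  rw [Finset.sum_congr rfl h5, Finset.sum_comm]
  refine Finset.sum_congr rfl fun z _ => ?_
  rw [Finset.sum_comm, Finset.mul_sum]
  refine Finset.sum_congr rfl fun r _ => ?_
  rw [Finset.mul_sum, Finset.mul_sum]

/-- Efron's monotonicity for two independent log-concave variables conditioned on their sum. -/
theorem sum_mul_conv_le (hp : IsPF2 w) (hw : ∀ i, 0 ≤ w i) {V : ℕ → ℝ} (hV : IsPF2 V)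
    (hV0 : ∀ i, 0 ≤ V i) (s : ℕ) {F F' : ℕ → ℝ} (hF : ∀ l ≤ s, F l ≤ F' l)
    (hF' : ∀ l ≤ s, F l ≤ F' (l + 1)) :
    (∑ x ∈ Finset.range (s + 1), w x * V (s - x) * F x) * conv w V (s + 1) ≤
      (∑ x ∈ Finset.range (s + 2), w x * V (s + 1 - x) * F' x) * conv w V s := by
  set p : ℕ → ℝ := fun x => w x * toeplitz V x s with hpdef
  set p' : ℕ → ℝ := fun x => w x * toeplitz V x (s + 1) with hp'def
  have ht : ∀ s, ∀ x ∈ Finset.range (s + 1), toeplitz V x s = V (s - x) := by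
    intro s x hx
    rw [toeplitz, if_pos (by simp at hx; omega)]
  have hp0 : ∀ x, 0 ≤ p x := fun x => mul_nonneg (hw _) (toeplitz_nonneg hV0 _ _)
  have hp'0 : ∀ x, 0 ≤ p' x := fun x => mul_nonneg (hw _) (toeplitz_nonneg hV0 _ _)
  have hP : conv w V s = ∑ l ∈ Finset.range (s + 1), p l := by
    rw [conv_eq_sum_sub]; exact Finset.sum_congr rfl fun x hx => by rw [← ht s x hx]
  have hP' : conv w V (s + 1) = ∑ l ∈ Finset.range (s + 1 + 1), p' l := by
    rw [conv_eq_sum_sub]; exact Finset.sum_congr rfl fun x hx => by rw [← ht (s + 1) x hx]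
  -- Log-concavity of `V`: raising the sum by one raises the first summand in the likelihood ratio
  -- order.
  have hlr : ∀ i j, i ≤ j → p j * p' i ≤ p i * p' j := by
    intro i j hij
    have := mul_le_mul_of_nonneg_left (hV.toeplitz_mul_le hV0 hij (Nat.le_succ s))
      (mul_nonneg (hw i) (hw j))
    simp only [hpdef, hp'def]
    linarith
  -- Log-concavity of `w`: it raises it by no more than one.
  have hlr' : ∀ i j, i ≤ j → p' (j + 1) * p i ≤ p' (i + 1) * p j := by
    intro i j hij
    have e : ∀ x, toeplitz V (x + 1) (s + 1) = toeplitz V x s := by intro x; simp [toeplitz]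
    obtain ⟨r, rfl⟩ := Nat.exists_eq_add_of_le hij
    simp only [hpdef, hp'def, e]
    have := mul_le_mul_of_nonneg_left (hp i r 1)
      (mul_nonneg (toeplitz_nonneg hV0 i s) (toeplitz_nonneg hV0 (i + r) s))
    linarith
  have hlast : p (s + 1) = 0 := by
    simp only [hpdef]; rw [toeplitz_of_lt V (Nat.lt_succ_self s), mul_zero]
  obtain ⟨stay, move, hs, hm, hN, h, h0, h'⟩ := exists_stay_move p p' (s + 1) (by
    intro k hk
    have := sum_mul_sum_le_of_ratio_mono (Finset.range (s + 2)) (fun i => if k ≤ i then 1 else 0)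
      (fun _ => 1) p p' (by
        intro i j hij; split_ifs <;> first | omega | norm_num) hlr
    have e : ∀ f : ℕ → ℝ, ∑ i ∈ Finset.range (s + 2), (if k ≤ i then 1 else 0) * f i =
        ∑ i ∈ Finset.Ico k (s + 2), f i := by
      intro f
      simp only [ite_mul, one_mul, zero_mul]
      rw [← Finset.sum_filter]
      refine Finset.sum_congr ?_ fun _ _ => rfl
      ext i; simp [and_comm]
    rw [e, e, Finset.sum_Ico_succ_top (by omega) p, hlast, add_zero] at this
    simp only [one_mul] at this
    rw [Finset.sum_range_succ p, hlast, add_zero] at this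
    exact this) (by
    intro k hk
    have := sum_mul_sum_le_of_ratio_mono (Finset.range (s + 1)) (fun _ => 1)
      (fun i => if i < k then 1 else 0) (fun i => p' (i + 1)) p (by
        intro i j hij; split_ifs <;> first | omega | norm_num) hlr'
    have e : ∀ f : ℕ → ℝ, ∑ i ∈ Finset.range (s + 1), (if i < k then 1 else 0) * f i =
        ∑ i ∈ Finset.range k, f i := by
      intro f
      simp only [ite_mul, one_mul, zero_mul]
      rw [← Finset.sum_filter]
      refine Finset.sum_congr ?_ fun _ _ => rfl
      ext i; simp; omega
    rw [e, e] at this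
    simp only [one_mul] at this
    -- The shifted comparison misses the atom of `p'` at `0`, which is added to both sides.
    rw [Finset.sum_range_succ' p', Finset.sum_range_succ' p']
    have h1 : ∑ i ∈ Finset.range k, p i ≤ ∑ i ∈ Finset.range (s + 1), p i :=
      Finset.sum_le_sum_of_subset_of_nonneg (Finset.range_mono hk) fun i _ _ => hp0 i
    have h2 := mul_le_mul_of_nonneg_right h1 (hp'0 0)
    linarith)
  have e1 : ∑ x ∈ Finset.range (s + 1), w x * V (s - x) * F x =
      ∑ x ∈ Finset.range (s + 1), p x * F x :=
    Finset.sum_congr rfl fun x hx => by rw [← ht s x hx]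
  have e2 : ∑ x ∈ Finset.range (s + 2), w x * V (s + 1 - x) * F' x =
      ∑ x ∈ Finset.range (s + 2), p' x * F' x :=
    Finset.sum_congr rfl fun x hx => by rw [← ht (s + 1) x hx]
  rw [hP, hP', e1, e2]
  exact sum_mul_le_of_stay_move hs hm hN h h0 h' (fun l hl => hF l (by omega))
    fun l hl => hF' l (by omega)

theorem walkStep_iterate_isPF2 (hp : IsPF2 w) (hw : ∀ i, 0 ≤ w i) {u : ℕ → ℝ} (hu : ∀ i, 0 ≤ u i)
    (hu2 : IsPF2 u) (k : ℕ) : IsPF2 ((walkStep w)^[k] u) := by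
  induction k with
  | zero => exact hu2
  | succ k ih =>
    intro p r s
    simp only [Function.iterate_succ_apply', walkStep]
    have := hp.conv hw ih (walkStep_iterate_nonneg hw hu k) (p + 1) r s
    rwa [show p + r + s + 1 = p + 1 + r + s by ring, show p + r + 1 = p + 1 + r by ring,
      show p + s + 1 = p + 1 + s by ring]

/-- The walk may stay at `0` by steps with one child. Hence the support of its weight is an initial
interval. -/
theorem walkStep_iterate_zero_pos (hw : ∀ i, 0 ≤ w i) (hw1 : 0 < w 1) {u : ℕ → ℝ}
    (hu : ∀ i, 0 ≤ u i) (hu0 : 0 < u 0) (k : ℕ) : 0 < (walkStep w)^[k] u 0 := by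
  induction k with
  | zero => exact hu0
  | succ k ih =>
    rw [Function.iterate_succ_apply', walkStep, conv_eq_sum_sub, Finset.sum_range_succ,
      Finset.sum_range_one]
    have := mul_nonneg (hw 0) (walkStep_iterate_nonneg hw hu k (0 + 1 - 0))
    have h2 : 0 < w (0 + 1) * (walkStep w)^[k] u (0 + 1 - (0 + 1)) := mul_pos hw1 ih
    linarith

theorem survivalWeight_nonneg (hw : ∀ i, 0 ≤ w i) {u : ℕ → ℝ} (hu : ∀ i, 0 ≤ u i) (k : ℕ) :
    ∀ y c, 0 ≤ survivalWeight w u k y c := by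
  induction k with
  | zero => intro y c; rw [survivalWeight]; split_ifs <;> simp [hu]
  | succ k ih =>
    intro y c; rw [survivalWeight]
    exact Finset.sum_nonneg fun x _ => mul_nonneg (hw x) (ih _ _)

theorem survivalWeight_le (hw : ∀ i, 0 ≤ w i) {u : ℕ → ℝ} (hu : ∀ i, 0 ≤ u i) (k : ℕ) :
    ∀ y c, survivalWeight w u k y c ≤ (walkStep w)^[k] u y := by
  induction k with
  | zero => intro y c; rw [survivalWeight]; split_ifs <;> simp [hu]
  | succ k ih =>
    intro y c
    rw [survivalWeight, Function.iterate_succ_apply', walkStep, conv_eq_sum_sub]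
    exact Finset.sum_le_sum fun x _ => mul_le_mul_of_nonneg_left (ih _ _) (hw x)

theorem survivalWeight_antitone (hw : ∀ i, 0 ≤ w i) {u : ℕ → ℝ} (hu : ∀ i, 0 ≤ u i) (k : ℕ) :
    ∀ y c c', c ≤ c' → survivalWeight w u k y c' ≤ survivalWeight w u k y c := by
  induction k with
  | zero =>
    intro y c c' h; rw [survivalWeight, survivalWeight]; split_ifs <;> first | omega | simp [hu]
  | succ k ih =>
    intro y c c' h; rw [survivalWeight, survivalWeight]
    exact Finset.sum_le_sum fun x _ => mul_le_mul_of_nonneg_left (ih _ _ _ (by omega)) (hw x)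

/-- The conditional probability of survival is non-decreasing in the final position. -/
theorem survivalWeight_ratio_succ (hp : IsPF2 w) (hw : ∀ i, 0 ≤ w i) (hw1 : 0 < w 1) {u : ℕ → ℝ}
    (hu : ∀ i, 0 ≤ u i) (hu2 : IsPF2 u) (hu0 : 0 < u 0) (k : ℕ) : ∀ y c,
    survivalWeight w u k y c * (walkStep w)^[k] u (y + 1) ≤
      survivalWeight w u k (y + 1) c * (walkStep w)^[k] u y := by
  induction k with
  | zero =>
    intro y c
    simp only [survivalWeight, Function.iterate_zero, id]
    split_ifs
    · exact (mul_comm _ _).le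
    · simp
  | succ k ih =>
    intro y c
    set V := (walkStep w)^[k] u with hVdef
    have hV0 : ∀ i, 0 ≤ V i := walkStep_iterate_nonneg hw hu k
    have hV2 : IsPF2 V := walkStep_iterate_isPF2 hp hw hu hu2 k
    have hVz : ∀ y, V y = 0 → V (y + 1) = 0 := by
      intro y hy
      have h1 := hV2 0 y 1
      rw [zero_add, hy, zero_mul] at h1
      have h2 : 0 < V 0 := walkStep_iterate_zero_pos hw hw1 hu hu0 k
      exact le_antisymm (le_of_mul_le_mul_left (by simpa using h1) h2) (hV0 _)
    -- The probability of survival given the position `y`. The value `1` outside the support of `V`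
    -- keeps it non-decreasing in `y`.
    let q : ℕ → ℕ → ℝ := fun y c => if V y = 0 then 1 else survivalWeight w u k y c / V y
    have hq : ∀ y c, survivalWeight w u k y c = V y * q y c := by
      intro y c
      by_cases h : V y = 0
      · have := survivalWeight_le hw hu k y c
        rw [← hVdef, h] at this
        rw [h, zero_mul]
        exact le_antisymm this (survivalWeight_nonneg hw hu k y c)
      · simp only [q]; rw [if_neg h]; field_simp
    have hq1 : ∀ y c, q y c ≤ q (y + 1) c := by
      intro y c
      simp only [q]
      by_cases h : V y = 0
      · rw [if_pos h, if_pos (hVz y h)]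
      have hpos : 0 < V y := lt_of_le_of_ne (hV0 y) (Ne.symm h)
      rw [if_neg h]
      by_cases h' : V (y + 1) = 0
      · rw [if_pos h', div_le_one hpos]; exact survivalWeight_le hw hu k y c
      rw [if_neg h', div_le_div_iff₀ hpos (lt_of_le_of_ne (hV0 _) (Ne.symm h'))]
      exact ih y c
    have hq2 : ∀ y c c', c ≤ c' → q y c' ≤ q y c := by
      intro y c c' h
      simp only [q]
      split_ifs
      · exact le_rfl
      · exact div_le_div_of_nonneg_right (survivalWeight_antitone hw hu k y c c' h) (hV0 y)
    -- Given the final position, the last step `x` and the previous position have a fixed sum. When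
    -- the sum grows by one, either the previous position grows, which helps by `hq1`, or `x` grows,
    -- which relaxes the constraint `c + 1 - x` and helps by `hq2`.
    have key := sum_mul_conv_le hp hw hV2 hV0 (y + 1) (F := fun x => q (y + 1 - x) (c + 1 - x))
      (F' := fun x => q (y + 2 - x) (c + 1 - x))
      (fun l hl => by
        rw [show y + 2 - l = y + 1 - l + 1 by omega]; exact hq1 _ _)
      (fun l hl => by
        rw [show y + 2 - (l + 1) = y + 1 - l by omega]; exact hq2 _ _ _ (by omega))
    simp only [Function.iterate_succ_apply', ← hVdef, walkStep, survivalWeight, hq, ← mul_assoc]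
    exact key

theorem survivalWeight_ratio_mono (hp : IsPF2 w) (hw : ∀ i, 0 ≤ w i) (hw1 : 0 < w 1) {u : ℕ → ℝ}
    (hu : ∀ i, 0 ≤ u i) (hu2 : IsPF2 u) (hu0 : 0 < u 0) (k c : ℕ) : ∀ i j, i ≤ j →
    survivalWeight w u k i c * (walkStep w)^[k] u j ≤
      survivalWeight w u k j c * (walkStep w)^[k] u i := by
  set V := (walkStep w)^[k] u with hVdef
  have hV0 : ∀ i, 0 ≤ V i := walkStep_iterate_nonneg hw hu k
  have hV2 : IsPF2 V := walkStep_iterate_isPF2 hp hw hu hu2 k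
  have hVp : 0 < V 0 := walkStep_iterate_zero_pos hw hw1 hu hu0 k
  intro i j hij
  induction j, hij using Nat.le_induction with
  | base => exact le_rfl
  | succ j hij ih =>
    by_cases h : V (j + 1) = 0
    · rw [h, mul_zero]; exact mul_nonneg (survivalWeight_nonneg hw hu k _ _) (hV0 _)
    have hj : 0 < V j := by
      refine lt_of_le_of_ne (hV0 j) fun hj => h ?_
      have h1 := hV2 0 j 1
      rw [zero_add, ← hj, zero_mul] at h1
      exact le_antisymm (le_of_mul_le_mul_left (by simpa using h1) hVp) (hV0 _)
    have h2 := survivalWeight_ratio_succ hp hw hw1 hu hu2 hu0 k j c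
    rw [← hVdef] at h2
    have h3 := mul_le_mul_of_nonneg_right ih (hV0 (j + 1))
    have h4 := mul_le_mul_of_nonneg_right h2 (hV0 i)
    refine le_of_mul_le_mul_right ?_ hj
    linarith

/-- The event `l ≥ k` means that the first subtree survives `k` steps of its exploration. -/
theorem firstSubtree_interlace (hp : IsPF2 w) (hw : ∀ i, 0 ≤ w i) (hw1 : 0 < w 1) (j N k : ℕ)
    (hj : 0 < w (j + 1)) (hk : k ≤ N) :
    (∑ l ∈ Finset.Ico k (N + 1), treeWeight w 0 l * treeWeight w (j + 1) (N - l)) *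
        treeWeight w j (N + 2) ≤
      (∑ l ∈ Finset.Ico k (N + 2), treeWeight w 0 l * treeWeight w (j + 1) (N + 1 - l)) *
        treeWeight w j (N + 1) := by
  obtain ⟨t, rfl⟩ := Nat.exists_eq_add_of_le hk
  have hu2 : IsPF2 fun y => w (j + 1 + y) := by
    intro p r s
    have := hp (j + 1 + p) r s
    simpa only [add_assoc] using this
  have h := forestPairing_ratio_mono hp hw
    (survivalWeight_ratio_mono hp hw hw1 (fun i => hw (j + 1 + i)) hu2 hj k 0)
    (show 1 ≤ t + 1 by omega)
  rw [forestPairing_walkStep_iterate w _ (by omega), forestPairing_walkStep_iterate w _ (by omega),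
    forestPairing_survivalWeight, forestPairing_survivalWeight,
    show t + 1 + 1 + k = k + t + 1 + 1 by omega, show t + 1 + k = k + t + 1 by omega,
    forestPairing_weight, forestPairing_weight] at h
  have e : ∀ t, ∑ l ∈ Finset.Ico k (k + t + 1), treeWeight w 0 l * treeWeight w (j + 1) (k + t - l) =
      ∑ l ∈ Finset.range (t + 1), treeWeight w 0 (k + l) * treeWeight w (j + 1) (t - l) := by
    intro t
    rw [Finset.sum_Ico_eq_sum_range, show k + t + 1 - k = t + 1 by omega]
    exact Finset.sum_congr rfl fun l _ => by rw [show k + t - (k + l) = t - l by omega]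
  have e2 := e (t + 1)
  rw [show k + (t + 1) + 1 = k + t + 2 by ring, show k + (t + 1) = k + t + 1 by ring] at e2
  rw [e, e2]
  exact h

/-- The laws of the size of the first subtree of trees of consecutive sizes are coupled so that
the size stays the same or increases by one. -/
theorem exists_firstSubtree_coupling (hlc : IsLogConcave w) (hw : ∀ i, 0 ≤ w i) (hw0 : 0 < w 0)
    (hw1 : 0 < w 1) (j N : ℕ) :
    ∃ stay move : ℕ → ℝ, (∀ l ≤ N + 1, 0 ≤ stay l) ∧ (∀ l ≤ N, 0 ≤ move l) ∧ stay (N + 1) = 0 ∧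
      (∀ l ≤ N, stay l + move l =
        treeWeight w 0 l * treeWeight w (j + 1) (N - l) * treeWeight w j (N + 2)) ∧
      stay 0 = treeWeight w 0 0 * treeWeight w (j + 1) (N + 1) * treeWeight w j (N + 1) ∧
      (∀ l ≤ N, stay (l + 1) + move l =
        treeWeight w 0 (l + 1) * treeWeight w (j + 1) (N - l) * treeWeight w j (N + 1)) := by
  -- As `w 0 > 0` and there are no internal zeros, `w` then vanishes from `j + 1` on: no tree has a
  -- first subtree and all the masses are zero.
  by_cases hj : w (j + 1) = 0
  · have h0 : ∀ n, treeWeight w (j + 1) n = 0 := by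
      intro n
      refine Finset.sum_eq_zero fun d _ => ?_
      have : w (j + 1 + d) = 0 := by
        by_contra hne
        exact hlc.no_internal_zeros 0 _ (j + 1) (by omega) (by omega) hw0.ne' hne hj
      rw [this, zero_mul]
    exact ⟨fun _ => 0, fun _ => 0, by simp [h0]⟩
  have hp := hlc.isPF2 hw
  have hj : 0 < w (j + 1) := lt_of_le_of_ne (hw _) (Ne.symm hj)
  have hnn : ∀ N l, 0 ≤ treeWeight w 0 l * treeWeight w (j + 1) (N - l) := fun N l =>
    mul_nonneg (treeWeight_nonneg w hw _ _) (treeWeight_nonneg w hw _ _)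
  obtain ⟨stay, move, h1, h2, h3, h4, h5, h6⟩ := exists_stay_move
    (fun l => treeWeight w 0 l * treeWeight w (j + 1) (N - l))
    (fun l => treeWeight w 0 l * treeWeight w (j + 1) (N + 1 - l)) (N + 1) (by
      intro k hk
      rw [← treeWeight_succ, ← treeWeight_succ]
      rcases Nat.lt_or_ge N k with h | h
      · rw [Finset.Ico_eq_empty (by omega), Finset.sum_empty, zero_mul]
        exact mul_nonneg (Finset.sum_nonneg fun l _ => hnn _ _) (treeWeight_nonneg w hw _ _)
      · exact firstSubtree_interlace hp hw hw1 j N k hj h) (by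
      intro k hk
      rw [← treeWeight_succ, ← treeWeight_succ]
      rcases Nat.lt_or_ge N k with h | h
      · obtain rfl : k = N + 1 := by omega
        rw [← treeWeight_succ, ← treeWeight_succ]
        exact (mul_comm _ _).le
      · exact remainder_interlace hp hw j N k h)
  simp only [← treeWeight_succ] at h4 h5 h6
  refine ⟨stay, move, h1, fun l hl => h2 l (by omega), h3, fun l hl => h4 l (by omega), h5,
    fun l hl => ?_⟩
  rw [h6 l (by omega), Nat.add_sub_add_right]

end survival

/-! ### Growth flows on binary trees. -/

namespace BinaryTree

/-- The weight of the plane tree encoded by a binary tree: `nil` encodes the single vertex and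
`l △ r` the plane tree whose root has a first subtree `l`, the remainder of the tree being `r`.
The root has weight `w (j + d)` if it has `d` children. -/
def planeWeight (w : ℕ → ℝ) : ℕ → BinaryTree Unit → ℝ
  | j, nil => w j
  | j, node _ l r => planeWeight w 0 l * planeWeight w (j + 1) r

/-- The encoding of the addition of a right-leaning leaf. -/
inductive GrowsTo : BinaryTree Unit → BinaryTree Unit → Prop
  | root : GrowsTo nil (nil △ nil)
  | left {l l' : BinaryTree Unit} (r : BinaryTree Unit) : GrowsTo l l' → GrowsTo (l △ r) (l' △ r)
  | right (l : BinaryTree Unit) {r r' : BinaryTree Unit} : GrowsTo r r' → GrowsTo (l △ r) (l △ r')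

theorem GrowsTo.numNodes_eq {T T' : BinaryTree Unit} (h : GrowsTo T T') :
    T'.numNodes = T.numNodes + 1 := by
  induction h with
  | root => rfl
  | left r _ ih => simp only [numNodes, ih]; ring
  | right l _ ih => simp only [numNodes, ih]; ring

theorem exists_growsTo (T : BinaryTree Unit) : ∃ T', GrowsTo T T' := by
  induction T with
  | nil => exact ⟨_, .root⟩
  | node a l r ihl _ =>
    obtain ⟨l', hl⟩ := ihl
    exact ⟨_, hl.left r⟩

theorem sum_treesOfNumNodesEq_succ (N : ℕ) (f : BinaryTree Unit → ℝ) :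
    ∑ T ∈ treesOfNumNodesEq (N + 1), f T = ∑ l ∈ Finset.range (N + 1),
      ∑ x ∈ treesOfNumNodesEq l, ∑ y ∈ treesOfNumNodesEq (N - l), f (x △ y) := by
  rw [treesOfNumNodesEq_succ, Finset.sum_biUnion]
  · rw [Finset.Nat.sum_antidiagonal_eq_sum_range_succ
      (fun i j => ∑ T ∈ pairwiseNode (treesOfNumNodesEq i) (treesOfNumNodesEq j), f T)]
    refine Finset.sum_congr rfl fun l _ => ?_
    rw [Finset.sum_map, Finset.sum_product]
    rfl
  · simp_rw [Set.PairwiseDisjoint, Set.Pairwise, Finset.disjoint_left]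
    aesop

theorem planeWeight_nonneg {w : ℕ → ℝ} (hw : ∀ i, 0 ≤ w i) (T : BinaryTree Unit) :
    ∀ j, 0 ≤ planeWeight w j T := by
  induction T with
  | nil => exact hw
  | node a l r ihl ihr => intro j; exact mul_nonneg (ihl 0) (ihr (j + 1))

theorem sum_planeWeight (w : ℕ → ℝ) (N : ℕ) : ∀ j,
    ∑ T ∈ treesOfNumNodesEq N, planeWeight w j T = treeWeight w j N := by
  induction N using Nat.strong_induction_on with
  | _ N ih =>
    intro j
    rcases N with _ | N
    · simp [planeWeight, treeWeight_zero]
    · rw [sum_treesOfNumNodesEq_succ, treeWeight_succ]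
      refine Finset.sum_congr rfl fun l hl => ?_
      rw [← ih l (by simpa using hl), ← ih (N - l) (by omega), Finset.sum_mul_sum]
      rfl

theorem planeWeight_eq_zero {w : ℕ → ℝ} (hw : ∀ i, 0 ≤ w i) {j : ℕ} {T : BinaryTree Unit}
    (h : treeWeight w j T.numNodes = 0) : planeWeight w j T = 0 := by
  rw [← sum_planeWeight, Finset.sum_eq_zero_iff_of_nonneg fun T _ => planeWeight_nonneg hw T j] at h
  exact h T (mem_treesOfNumNodesEq_numNodes T)

theorem sum_ite_left {M : ℕ} {x : BinaryTree Unit} (hx : x.numNodes ≤ M)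
    (g : BinaryTree Unit → ℝ) :
    ∑ l ∈ Finset.range (M + 1), ∑ x' ∈ treesOfNumNodesEq l, ∑ y' ∈ treesOfNumNodesEq (M - l),
      (if x = x' then g y' else 0) = ∑ y' ∈ treesOfNumNodesEq (M - x.numNodes), g y' := by
  rw [Finset.sum_eq_single_of_mem x.numNodes (by simp; omega)]
  · rw [Finset.sum_eq_single_of_mem x (mem_treesOfNumNodesEq_numNodes x)]
    · simp
    · intro x' _ hne
      exact Finset.sum_eq_zero fun y _ => if_neg (Ne.symm hne)
  · intro l _ hne
    refine Finset.sum_eq_zero fun x' hx' => Finset.sum_eq_zero fun y _ => if_neg ?_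
    rintro rfl
    exact hne (mem_treesOfNumNodesEq.1 hx').symm

theorem sum_ite_left_of_lt {M : ℕ} {x : BinaryTree Unit} (hx : M < x.numNodes)
    (g : BinaryTree Unit → ℝ) :
    ∑ l ∈ Finset.range (M + 1), ∑ x' ∈ treesOfNumNodesEq l, ∑ y' ∈ treesOfNumNodesEq (M - l),
      (if x = x' then g y' else 0) = 0 := by
  refine Finset.sum_eq_zero fun l hl => Finset.sum_eq_zero fun x' hx' =>
    Finset.sum_eq_zero fun y _ => if_neg ?_
  rintro rfl
  rw [mem_treesOfNumNodesEq] at hx'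
  simp at hl; omega

theorem sum_reflect (M : ℕ) (f : BinaryTree Unit → BinaryTree Unit → ℝ) :
    ∑ l ∈ Finset.range (M + 1), ∑ x' ∈ treesOfNumNodesEq l, ∑ y' ∈ treesOfNumNodesEq (M - l),
      f x' y' = ∑ l ∈ Finset.range (M + 1), ∑ y' ∈ treesOfNumNodesEq l,
        ∑ x' ∈ treesOfNumNodesEq (M - l), f x' y' := by
  rw [← Finset.sum_range_reflect]
  refine Finset.sum_congr rfl fun l hl => ?_
  have hl : l ≤ M := by simpa [Nat.lt_succ_iff] using hl
  rw [Finset.sum_comm, Nat.add_sub_cancel, Nat.sub_sub_self hl]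

theorem sum_ite_right {M : ℕ} {y : BinaryTree Unit} (hy : y.numNodes ≤ M)
    (g : BinaryTree Unit → ℝ) :
    ∑ l ∈ Finset.range (M + 1), ∑ x' ∈ treesOfNumNodesEq l, ∑ y' ∈ treesOfNumNodesEq (M - l),
      (if y = y' then g x' else 0) = ∑ x' ∈ treesOfNumNodesEq (M - y.numNodes), g x' := by
  rw [sum_reflect]; exact sum_ite_left hy g

theorem sum_ite_right_of_lt {M : ℕ} {y : BinaryTree Unit} (hy : M < y.numNodes)
    (g : BinaryTree Unit → ℝ) :
    ∑ l ∈ Finset.range (M + 1), ∑ x' ∈ treesOfNumNodesEq l, ∑ y' ∈ treesOfNumNodesEq (M - l),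
      (if y = y' then g x' else 0) = 0 := by
  rw [sum_reflect]; exact sum_ite_left_of_lt hy g

/-- An unnormalised coupling of the laws of weighted trees with `N` and `N + 1` non-root vertices
which adds a right-leaning leaf. -/
structure IsGrowthFlow (w : ℕ → ℝ) (j N : ℕ) (φ : BinaryTree Unit → BinaryTree Unit → ℝ) :
    Prop where
  nonneg : ∀ T T', 0 ≤ φ T T'
  growsTo : ∀ T T', φ T T' ≠ 0 → GrowsTo T T'
  sum_right : ∀ T ∈ treesOfNumNodesEq N, ∑ T' ∈ treesOfNumNodesEq (N + 1), φ T T' =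
    planeWeight w j T * treeWeight w j (N + 1)
  sum_left : ∀ T' ∈ treesOfNumNodesEq (N + 1), ∑ T ∈ treesOfNumNodesEq N, φ T T' =
    planeWeight w j T' * treeWeight w j N

theorem exists_isGrowthFlow_zero {w : ℕ → ℝ} (hw : ∀ i, 0 ≤ w i) (j : ℕ) :
    ∃ φ, IsGrowthFlow w j 0 φ := by
  have h1 : treesOfNumNodesEq 1 = {nil △ nil} := by
    ext T
    rw [mem_treesOfNumNodesEq, Finset.mem_singleton]
    rcases T with _ | ⟨_, l, r⟩
    · simp
    · rcases l with _ | _ <;> rcases r with _ | _ <;> simp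
  refine ⟨fun T T' => if T = nil ∧ T' = nil △ nil then w 0 * w (j + 1) * w j else 0, ?_, ?_, ?_, ?_⟩
  · intro T T'
    split_ifs
    · exact mul_nonneg (mul_nonneg (hw _) (hw _)) (hw _)
    · exact le_rfl
  · intro T T' h
    have : T = nil ∧ T' = nil △ nil := by
      by_contra hc; exact h (if_neg hc)
    rw [this.1, this.2]; exact .root
  · simp [h1, planeWeight, treeWeight_succ, treeWeight_zero]; ring
  · simp [h1, planeWeight, treeWeight_zero]

/-- The flow on trees with a first subtree obtained by letting either the first subtree or the
remainder grow. -/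
noncomputable def glueFlow (w : ℕ → ℝ) (j : ℕ) (stay move : ℕ → ℝ)
    (φ₀ φ₁ : ℕ → BinaryTree Unit → BinaryTree Unit → ℝ) :
    BinaryTree Unit → BinaryTree Unit → ℝ
  | node _ x y, node _ x' y' =>
    (if x = x' then
      stay x.numNodes * (planeWeight w 0 x / treeWeight w 0 x.numNodes) *
        (φ₁ y.numNodes y y' /
          (treeWeight w (j + 1) y.numNodes * treeWeight w (j + 1) (y.numNodes + 1))) else 0) +
    (if y = y' then
      move x.numNodes * (planeWeight w (j + 1) y / treeWeight w (j + 1) y.numNodes) *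
        (φ₀ x.numNodes x x' /
          (treeWeight w 0 x.numNodes * treeWeight w 0 (x.numNodes + 1))) else 0)
  | _, _ => 0

theorem treeWeight_zero_pos {w : ℕ → ℝ} (hw : ∀ i, 0 ≤ w i) (hw0 : 0 < w 0) (hw1 : 0 < w 1)
    (N : ℕ) : 0 < treeWeight w 0 N := by
  induction N with
  | zero => rwa [treeWeight_zero]
  | succ N ih =>
    rw [treeWeight_succ]
    refine lt_of_lt_of_le (mul_pos ih (?_ : 0 < treeWeight w (0 + 1) (N - N)))
      (Finset.single_le_sum (f := fun l => treeWeight w 0 l * treeWeight w (0 + 1) (N - l))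
        (fun l _ => mul_nonneg (treeWeight_nonneg w hw _ _) (treeWeight_nonneg w hw _ _))
        (Finset.self_mem_range_succ N))
    rwa [Nat.sub_self, treeWeight_zero]

/-- The coupling of sizes decides which part grows; given the sizes, the other part is drawn
according to its weight and the growing part follows its own flow, of shift `0` for the first
subtree and `j + 1` for the remainder. -/
theorem exists_isGrowthFlow_succ {w : ℕ → ℝ} (hlc : IsLogConcave w) (hw : ∀ i, 0 ≤ w i)
    (hw0 : 0 < w 0) (hw1 : 0 < w 1) (N : ℕ) (ih : ∀ m ≤ N, ∀ j, ∃ φ, IsGrowthFlow w j m φ)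
    (j : ℕ) : ∃ φ, IsGrowthFlow w j (N + 1) φ := by
  obtain ⟨stay, move, hs, hm, hsN, hrow, hcol0, hcol⟩ :=
    exists_firstSubtree_coupling hlc hw hw0 hw1 j N
  choose! φ hφ using ih
  set a := treeWeight w 0 with ha
  set b := treeWeight w (j + 1) with hb
  have hapos : ∀ n, 0 < a n := treeWeight_zero_pos hw hw0 hw1
  have hbnn : ∀ n, 0 ≤ b n := treeWeight_nonneg w hw (j + 1)
  have hWb : ∀ y, b y.numNodes = 0 → planeWeight w (j + 1) y = 0 := fun y h =>
    planeWeight_eq_zero hw h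
  -- The total weights `b` may vanish. With `hstay'`, this shows that `stay` then vanishes too, so
  -- the quotients by zero in `glueFlow`, equal to `0`, do no harm.
  have hstay : ∀ l ≤ N, b (N + 1 - l) = 0 → stay l = 0 := by
    rintro (_ | l) hl h
    · rw [hcol0, show b (N + 1) = 0 from h]; ring
    · have h1 := hcol l (by omega)
      rw [show N - l = N + 1 - (l + 1) by omega, h] at h1
      have := hs (l + 1) (by omega); have := hm l (by omega)
      linarith
  have hstay' : ∀ l ≤ N, b (N - l) = 0 → stay l = 0 := by
    intro l hl h
    have h1 := hrow l hl
    rw [h] at h1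
    have := hs l (by omega); have := hm l hl
    linarith
  -- outside the relevant range of sizes the flow is cut off
  let st : ℕ → ℝ := fun l => if l ≤ N then stay l else 0
  let mv : ℕ → ℝ := fun l => if l ≤ N then move l else 0
  let cut : ℕ → ℕ → BinaryTree Unit → BinaryTree Unit → ℝ :=
    fun i m T T' => if m ≤ N then φ m i T T' else 0
  have cut_nonneg : ∀ i m T T', 0 ≤ cut i m T T' := by
    intro i m T T'; simp only [cut]; split_ifs with h
    exacts [(hφ m h i).nonneg T T', le_rfl]
  have cut_grows : ∀ i m T T', cut i m T T' ≠ 0 → GrowsTo T T' := by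
    intro i m T T' hne
    simp only [cut] at hne; split_ifs at hne with h
    · exact (hφ m h i).growsTo T T' hne
    · exact absurd rfl hne
  have cut_eq : ∀ i m, m ≤ N → cut i m = φ m i := by
    intro i m h; funext T T'; simp [cut, h]
  refine ⟨glueFlow w j st mv (cut 0) (cut (j + 1)), ?_, ?_, ?_, ?_⟩
  · rintro (_ | ⟨_, x, y⟩) (_ | ⟨_, x', y'⟩)
    · exact le_rfl
    · exact le_rfl
    · exact le_rfl
    · simp only [glueFlow]
      refine add_nonneg ?_ ?_
      · split_ifs
        · refine mul_nonneg (mul_nonneg ?_ (div_nonneg (planeWeight_nonneg hw _ _) (hapos _).le))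
            (div_nonneg (cut_nonneg _ _ _ _) (mul_nonneg (hbnn _) (hbnn _)))
          simp only [st]; split_ifs with h
          exacts [hs _ (by omega), le_rfl]
        · exact le_rfl
      · split_ifs
        · refine mul_nonneg (mul_nonneg ?_ (div_nonneg (planeWeight_nonneg hw _ _) (hbnn _)))
            (div_nonneg (cut_nonneg _ _ _ _) (mul_nonneg (hapos _).le (hapos _).le))
          simp only [mv]; split_ifs with h
          exacts [hm _ h, le_rfl]
        · exact le_rfl
  · rintro (_ | ⟨_, x, y⟩) (_ | ⟨_, x', y'⟩) hne
    · exact absurd rfl hne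
    · exact absurd rfl hne
    · exact absurd rfl hne
    · simp only [glueFlow] at hne
      by_cases h1 : x = x' ∧ cut (j + 1) y.numNodes y y' ≠ 0
      · obtain ⟨rfl, h1⟩ := h1
        exact (cut_grows _ _ _ _ h1).right x
      by_cases h2 : y = y' ∧ cut 0 x.numNodes x x' ≠ 0
      · obtain ⟨rfl, h2⟩ := h2
        exact (cut_grows _ _ _ _ h2).left y
      refine absurd ?_ hne
      have e1 : x = x' → cut (j + 1) y.numNodes y y' = 0 := fun h => by
        by_contra hc; exact h1 ⟨h, hc⟩
      have e2 : y = y' → cut 0 x.numNodes x x' = 0 := fun h => by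
        by_contra hc; exact h2 ⟨h, hc⟩
      have z1 : ∀ A B : ℝ, (if x = x' then A * (cut (j + 1) y.numNodes y y' / B) else 0) = 0 := by
        intro A B; split_ifs with h
        · rw [e1 h]; simp
        · rfl
      have z2 : ∀ A B : ℝ, (if y = y' then A * (cut 0 x.numNodes x x' / B) else 0) = 0 := by
        intro A B; split_ifs with h
        · rw [e2 h]; simp
        · rfl
      rw [z1, z2, add_zero]
  · rintro (_ | ⟨_, x, y⟩) hT
    · simp at hT
    have hxy : x.numNodes + y.numNodes = N := by simpa using hT
    rw [sum_treesOfNumNodesEq_succ]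
    simp only [glueFlow, Finset.sum_add_distrib]
    rw [sum_ite_left (by omega), sum_ite_right (by omega), ← Finset.mul_sum, ← Finset.mul_sum,
      ← Finset.sum_div, ← Finset.sum_div, cut_eq _ _ (by omega), cut_eq _ _ (by omega),
      show N + 1 - x.numNodes = y.numNodes + 1 by omega,
      show N + 1 - y.numNodes = x.numNodes + 1 by omega,
      (hφ _ (by omega) _).sum_right y (mem_treesOfNumNodesEq_numNodes y),
      (hφ _ (by omega) _).sum_right x (mem_treesOfNumNodesEq_numNodes x)]
    simp only [st, mv]
    rw [if_pos (by omega), if_pos (by omega), planeWeight, ← ha, ← hb]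
    have h1 := hrow x.numNodes (by omega)
    have h2 := hstay x.numNodes (by omega)
    rw [show N - x.numNodes = y.numNodes by omega] at h1
    rw [show N + 1 - x.numNodes = y.numNodes + 1 by omega] at h2
    by_cases hby : b y.numNodes = 0
    · simp [hWb y hby]
    have ha1 := (hapos x.numNodes).ne'
    have ha2 := (hapos (x.numNodes + 1)).ne'
    have e : stay x.numNodes * (planeWeight w 0 x / a x.numNodes) *
        (planeWeight w (j + 1) y * b (y.numNodes + 1) / (b y.numNodes * b (y.numNodes + 1))) =
        stay x.numNodes * planeWeight w 0 x * planeWeight w (j + 1) y /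
          (a x.numNodes * b y.numNodes) := by
      by_cases hby' : b (y.numNodes + 1) = 0
      · rw [h2 hby']; simp
      · field_simp
    rw [e]
    field_simp
    linear_combination planeWeight w 0 x * planeWeight w (j + 1) y * h1
  · rintro (_ | ⟨_, x, y⟩) hT
    · simp at hT
    have hxy : x.numNodes + y.numNodes = N + 1 := by simpa using hT
    rw [sum_treesOfNumNodesEq_succ]
    simp only [glueFlow, Finset.sum_add_distrib, ← ha, ← hb]
    have swap1 : ∀ x' y', (if x' = x then st x'.numNodes * (planeWeight w 0 x' / a x'.numNodes) *
        (cut (j + 1) y'.numNodes y' y / (b y'.numNodes * b (y'.numNodes + 1))) else 0) =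
        if x = x' then st x.numNodes * (planeWeight w 0 x / a x.numNodes) *
        (cut (j + 1) y'.numNodes y' y / (b y'.numNodes * b (y'.numNodes + 1))) else 0 := by
      intro x' y'
      by_cases h : x' = x
      · subst h; rfl
      · rw [if_neg h, if_neg (Ne.symm h)]
    have swap2 : ∀ x' y', (if y' = y then mv x'.numNodes *
        (planeWeight w (j + 1) y' / b y'.numNodes) *
        (cut 0 x'.numNodes x' x / (a x'.numNodes * a (x'.numNodes + 1))) else 0) =
        if y = y' then mv x'.numNodes * (planeWeight w (j + 1) y / b y.numNodes) *
        (cut 0 x'.numNodes x' x / (a x'.numNodes * a (x'.numNodes + 1))) else 0 := by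
      intro x' y'
      by_cases h : y' = y
      · subst h; rfl
      · rw [if_neg h, if_neg (Ne.symm h)]
    simp only [swap1, swap2]
    have first : ∑ l ∈ Finset.range (N + 1), ∑ x' ∈ treesOfNumNodesEq l,
        ∑ y' ∈ treesOfNumNodesEq (N - l),
          (if x = x' then st x.numNodes * (planeWeight w 0 x / a x.numNodes) *
            (cut (j + 1) y'.numNodes y' y / (b y'.numNodes * b (y'.numNodes + 1))) else 0) =
        stay x.numNodes * (planeWeight w 0 x * planeWeight w (j + 1) y) /
          (a x.numNodes * b y.numNodes) := by
      rcases Nat.lt_or_ge N x.numNodes with hx | hx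
      · rw [sum_ite_left_of_lt hx, show x.numNodes = N + 1 by omega, hsN]; simp
      · obtain ⟨m, hm'⟩ := Nat.exists_eq_add_of_le' (show 1 ≤ y.numNodes by omega)
        rw [sum_ite_left hx, ← Finset.mul_sum, show N - x.numNodes = m by omega]
        have e : ∀ y' ∈ treesOfNumNodesEq m, cut (j + 1) y'.numNodes y' y /
            (b y'.numNodes * b (y'.numNodes + 1)) = φ m (j + 1) y' y / (b m * b (m + 1)) := by
          intro y' hy'
          rw [mem_treesOfNumNodesEq.1 hy', cut_eq _ _ (by omega)]
        rw [Finset.sum_congr rfl e, ← Finset.sum_div, (hφ m (by omega) _).sum_left y (by simp [hm']),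
          ← hb, hm']
        simp only [st]
        rw [if_pos hx]
        have h2 := hstay' x.numNodes hx
        rw [show N - x.numNodes = m by omega] at h2
        by_cases hbm : b m = 0
        · rw [h2 hbm]; simp
        have ha1 := (hapos x.numNodes).ne'
        field_simp
    have second : ∑ l ∈ Finset.range (N + 1), ∑ x' ∈ treesOfNumNodesEq l,
        ∑ y' ∈ treesOfNumNodesEq (N - l),
          (if y = y' then mv x'.numNodes * (planeWeight w (j + 1) y / b y.numNodes) *
            (cut 0 x'.numNodes x' x / (a x'.numNodes * a (x'.numNodes + 1))) else 0) =
        (if x.numNodes = 0 then 0 else move (x.numNodes - 1)) *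
          (planeWeight w 0 x * planeWeight w (j + 1) y) / (a x.numNodes * b y.numNodes) := by
      rcases Nat.lt_or_ge N y.numNodes with hy | hy
      · rw [sum_ite_right_of_lt hy, if_pos (by omega)]; simp
      · obtain ⟨m, hm'⟩ := Nat.exists_eq_add_of_le' (show 1 ≤ x.numNodes by omega)
        rw [sum_ite_right hy, show N - y.numNodes = m by omega]
        have e : ∀ x' ∈ treesOfNumNodesEq m,
            mv x'.numNodes * (planeWeight w (j + 1) y / b y.numNodes) * (cut 0 x'.numNodes x' x /
              (a x'.numNodes * a (x'.numNodes + 1))) =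
            move m * (planeWeight w (j + 1) y / b y.numNodes) *
              (φ m 0 x' x / (a m * a (m + 1))) := by
          intro x' hx'
          rw [mem_treesOfNumNodesEq.1 hx', cut_eq _ _ (by omega)]
          simp only [mv]
          rw [if_pos (by omega)]
        rw [Finset.sum_congr rfl e, ← Finset.mul_sum, ← Finset.sum_div,
          (hφ m (by omega) _).sum_left x (by simp [hm']), ← ha, hm', if_neg (by omega),
          Nat.add_sub_cancel]
        have ha1 := (hapos m).ne'
        have ha2 := (hapos (m + 1)).ne'
        field_simp
    rw [first, second, planeWeight]
    by_cases hby : b y.numNodes = 0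
    · simp [hWb y hby]
    have ha1 := (hapos x.numNodes).ne'
    have h1 : stay x.numNodes + (if x.numNodes = 0 then 0 else move (x.numNodes - 1)) =
        a x.numNodes * b y.numNodes * treeWeight w j (N + 1) := by
      rcases hn : x.numNodes with _ | m
      · rw [if_pos rfl, add_zero, hcol0, show y.numNodes = N + 1 by omega]
      · rw [if_neg (by omega), Nat.add_sub_cancel, hcol m (by omega),
          show y.numNodes = N - m by omega]
    rw [← add_div, ← add_mul, h1]
    field_simp

theorem exists_isGrowthFlow {w : ℕ → ℝ} (hlc : IsLogConcave w) (hw : ∀ i, 0 ≤ w i)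
    (hw0 : 0 < w 0) (hw1 : 0 < w 1) (N : ℕ) : ∀ j, ∃ φ, IsGrowthFlow w j N φ := by
  induction N using Nat.strong_induction_on with
  | _ N ih =>
    rcases N with _ | N
    · exact exists_isGrowthFlow_zero hw
    · exact exists_isGrowthFlow_succ hlc hw hw0 hw1 N fun m hm => ih m (by omega)

end BinaryTree

/-! ### Encoding of plane trees by binary trees. -/

namespace PlaneTree

/-- Moving the subtree of the `i`-th child of the root to the `i + 1`-th child. -/
def bump : List ℕ+ → List ℕ+
  | [] => []
  | i :: u => (i + 1) :: u

theorem bump_injective : Function.Injective bump := by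
  rintro (_ | ⟨i, u⟩) (_ | ⟨j, v⟩) h <;> simp_all [bump]

theorem cons_one_injective : Function.Injective (fun u : List ℕ+ => (1 : ℕ+) :: u) := by
  intro u v h; simpa using h

theorem word_cases {motive : List ℕ+ → Prop} (nil : motive [])
    (one : ∀ u, motive (1 :: u)) (bump : ∀ i u, motive ((i + 1) :: u)) (u : List ℕ+) :
    motive u := by
  rcases u with _ | ⟨i, u⟩
  · exact nil
  · induction i using PNat.recOn with
    | one => exact one u
    | succ i _ => exact bump i u

theorem mem_of_append_mem (T : PlaneTree) (u v : List ℕ+) (h : u ++ v ∈ T.verts) :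
    u ∈ T.verts := by
  induction v using List.reverseRecOn with
  | nil => simpa using h
  | append_singleton v i ih =>
    rw [← List.append_assoc] at h
    exact ih (T.parent_mem _ _ h)

theorem nil_mem (T : PlaneTree) : [] ∈ T.verts := by
  obtain ⟨u, hu⟩ := T.nonempty
  exact T.mem_of_append_mem [] u hu

theorem numChildren_eq (T : PlaneTree) (v : List ℕ+) (i : ℕ+)
    (hi : v ++ [i] ∉ T.verts) (h : ∀ k < i, v ++ [k] ∈ T.verts) :
    (i : ℕ) = T.numChildren v + 1 := by
  have : {k : ℕ+ | v ++ [k] ∈ T.verts} = (Finset.Iio i : Finset ℕ+) := by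
    ext k
    simp only [Set.mem_ofPred_eq, Finset.coe_Iio, Set.mem_Iio]
    refine ⟨fun hk => ?_, h k⟩
    by_contra hc
    exact hi (T.left_mem v k i hk (not_lt.1 hc))
  rw [numChildren, this, Set.ncard_coe_finset]
  have e : (Finset.Iio i).card = (i : ℕ) - 1 := by
    rw [← Finset.Ico_bot, PNat.card_Ico]; rfl
  have := i.pos
  omega

/-- A plane tree with one more vertex is obtained by adding a right-leaning leaf. -/
theorem addsRightLeaningLeaf_of_insert {T T' : PlaneTree} {p : List ℕ+} (hp : p ∉ T.verts)
    (h : T'.verts = insert p T.verts) : T.AddsRightLeaningLeaf T' := by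
  have hmem : ∀ u, u ∈ T'.verts ↔ u = p ∨ u ∈ T.verts := by intro u; rw [h, Finset.mem_insert]
  rcases List.eq_nil_or_concat p with rfl | ⟨v, i, hvi⟩
  · exact absurd T.nil_mem hp
  rw [List.concat_eq_append] at hvi
  subst hvi
  have hpT' : v ++ [i] ∈ T'.verts := (hmem _).2 (Or.inl rfl)
  have hv : v ∈ T.verts := by
    rcases (hmem v).1 (T'.parent_mem v i hpT') with h1 | h1
    · exact absurd (congrArg List.length h1) (by simp)
    · exact h1
  -- Closure of `T'` under left siblings puts every `v ++ [k]` with `k < i` in `T`; closure of `T`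
  -- under parents forbids children of the new vertex.
  refine ⟨v, hv, i, T.numChildren_eq v i hp fun k hk => ?_, hp, h, hpT', ?_⟩
  · rcases (hmem _).1 (T'.left_mem v i k hpT' hk.le) with h1 | h1
    · simp at h1; exact absurd h1 hk.ne
    · exact h1
  · rw [numChildren]
    convert Set.ncard_empty ℕ+
    ext k
    simp only [Set.mem_ofPred_eq, Set.mem_empty_iff_false, iff_false, hmem, not_or]
    refine ⟨fun h1 => absurd (congrArg List.length h1) (by simp), fun h1 => hp (T.parent_mem _ k h1)⟩

end PlaneTree

namespace BinaryTree

open PlaneTree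

/-- The vertices of the plane tree encoded by a binary tree. -/
def planeVerts : BinaryTree Unit → Finset (List ℕ+)
  | nil => {[]}
  | node _ l r => (planeVerts l).map ⟨_, cons_one_injective⟩ ∪ (planeVerts r).map ⟨_, bump_injective⟩

theorem pnat_one_ne_add_one (i : ℕ+) : (1 : ℕ+) ≠ i + 1 := (PNat.lt_add_left 1 i).ne

theorem nil_mem_planeVerts_node (l r : BinaryTree Unit) :
    [] ∈ planeVerts (l △ r) ↔ [] ∈ planeVerts r := by
  simp only [planeVerts, Finset.mem_union, Finset.mem_map, Function.Embedding.coeFn_mk]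
  constructor
  · rintro (⟨u, _, h⟩ | ⟨u, hu, h⟩)
    · simp at h
    · rcases u with _ | ⟨i, u⟩
      · exact hu
      · simp [bump] at h
  · exact fun h => Or.inr ⟨[], h, rfl⟩

theorem one_cons_mem_planeVerts_node (l r : BinaryTree Unit) (u : List ℕ+) :
    1 :: u ∈ planeVerts (l △ r) ↔ u ∈ planeVerts l := by
  simp only [planeVerts, Finset.mem_union, Finset.mem_map, Function.Embedding.coeFn_mk]
  constructor
  · rintro (⟨v, hv, h⟩ | ⟨v, hv, h⟩)
    · simp at h; exact h ▸ hv
    · rcases v with _ | ⟨i, v⟩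
      · simp [bump] at h
      · simp only [bump, List.cons.injEq] at h
        exact absurd h.1.symm (pnat_one_ne_add_one i)
  · exact fun h => Or.inl ⟨u, h, rfl⟩

theorem succ_cons_mem_planeVerts_node (l r : BinaryTree Unit) (i : ℕ+) (u : List ℕ+) :
    (i + 1) :: u ∈ planeVerts (l △ r) ↔ i :: u ∈ planeVerts r := by
  simp only [planeVerts, Finset.mem_union, Finset.mem_map, Function.Embedding.coeFn_mk]
  constructor
  · rintro (⟨v, hv, h⟩ | ⟨v, hv, h⟩)
    · simp only [List.cons.injEq] at h
      exact absurd h.1 (pnat_one_ne_add_one i)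
    · rcases v with _ | ⟨k, v⟩
      · simp [bump] at h
      · simp only [bump, List.cons.injEq, add_left_inj] at h
        rw [← h.1, ← h.2]; exact hv
  · exact fun h => Or.inr ⟨_, h, rfl⟩

theorem nil_mem_planeVerts (T : BinaryTree Unit) : [] ∈ planeVerts T := by
  induction T with
  | nil => simp [planeVerts]
  | node a l r _ ihr => exact (nil_mem_planeVerts_node l r).2 ihr

theorem planeVerts_parent_mem (T : BinaryTree Unit) :
    ∀ (u : List ℕ+) (i : ℕ+), u ++ [i] ∈ planeVerts T → u ∈ planeVerts T := by
  induction T with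
  | nil => intro u i h; simp [planeVerts] at h
  | node a l r ihl ihr =>
    intro u i
    induction u using word_cases with
    | nil => intro _; exact nil_mem_planeVerts _
    | one u =>
      rw [List.cons_append, one_cons_mem_planeVerts_node, one_cons_mem_planeVerts_node]
      exact ihl u i
    | bump k u =>
      rw [List.cons_append, succ_cons_mem_planeVerts_node, succ_cons_mem_planeVerts_node]
      exact ihr (k :: u) i

theorem planeVerts_left_mem (T : BinaryTree Unit) : ∀ (u : List ℕ+) (i j : ℕ+),
    u ++ [i] ∈ planeVerts T → j ≤ i → u ++ [j] ∈ planeVerts T := by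
  induction T with
  | nil => intro u i j h; simp [planeVerts] at h
  | node a l r ihl ihr =>
    intro u i j
    induction u using word_cases with
    | nil =>
      intro h hij
      simp only [List.nil_append] at h ⊢
      induction j using PNat.recOn with
      | one => exact (one_cons_mem_planeVerts_node l r []).2 (nil_mem_planeVerts l)
      | succ j _ =>
        induction i using PNat.recOn with
        | one => exact absurd hij (not_le.2 (PNat.lt_add_left 1 j))
        | succ i _ =>
          rw [succ_cons_mem_planeVerts_node] at h ⊢
          exact ihr [] i j h (by simpa using hij)
    | one u =>
      rw [List.cons_append, one_cons_mem_planeVerts_node, List.cons_append,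
        one_cons_mem_planeVerts_node]
      exact ihl u i j
    | bump k u =>
      rw [List.cons_append, succ_cons_mem_planeVerts_node, List.cons_append,
        succ_cons_mem_planeVerts_node]
      exact ihr (k :: u) i j

/-- The plane tree encoded by a binary tree. -/
def toPlane (T : BinaryTree Unit) : PlaneTree where
  verts := planeVerts T
  nonempty := ⟨[], nil_mem_planeVerts T⟩
  parent_mem := planeVerts_parent_mem T
  left_mem := planeVerts_left_mem T

theorem disjoint_planeVerts (l r : BinaryTree Unit) :
    Disjoint ((planeVerts l).map ⟨_, cons_one_injective⟩)
      ((planeVerts r).map ⟨_, bump_injective⟩) := by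
  rw [Finset.disjoint_left]
  intro u hu hu'
  simp only [Finset.mem_map, Function.Embedding.coeFn_mk] at hu hu'
  obtain ⟨v, _, rfl⟩ := hu
  obtain ⟨v', _, h⟩ := hu'
  rcases v' with _ | ⟨i, v'⟩
  · simp [bump] at h
  · simp only [bump, List.cons.injEq] at h
    exact pnat_one_ne_add_one i h.1.symm

theorem card_planeVerts (T : BinaryTree Unit) : (planeVerts T).card = T.numNodes + 1 := by
  induction T with
  | nil => rfl
  | node a l r ihl ihr =>
    rw [planeVerts, Finset.card_union_of_disjoint (disjoint_planeVerts l r), Finset.card_map,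
      Finset.card_map, ihl, ihr, numNodes]
    ring

theorem GrowsTo.exists_insert {T T' : BinaryTree Unit} (h : GrowsTo T T') :
    ∃ p ∉ planeVerts T, planeVerts T' = insert p (planeVerts T) := by
  induction h with
  | root => exact ⟨[1], by simp [planeVerts], by decide⟩
  | @left l l' r _ ih =>
    obtain ⟨p, hp, hT⟩ := ih
    refine ⟨1 :: p, by rwa [one_cons_mem_planeVerts_node], ?_⟩
    rw [planeVerts, planeVerts, hT, Finset.map_insert, Finset.insert_union]
    rfl
  | @right l r r' _ ih =>
    obtain ⟨p, hp, hT⟩ := ih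
    refine ⟨bump p, ?_, ?_⟩
    · rcases p with _ | ⟨i, p⟩
      · exact absurd (nil_mem_planeVerts r) hp
      · rw [bump, succ_cons_mem_planeVerts_node]; exact hp
    · rw [planeVerts, planeVerts, hT, Finset.map_insert, Finset.union_insert]
      rfl

theorem GrowsTo.addsRightLeaningLeaf {T T' : BinaryTree Unit} (h : GrowsTo T T') :
    (toPlane T).AddsRightLeaningLeaf (toPlane T') := by
  obtain ⟨p, hp, hT⟩ := h.exists_insert
  exact addsRightLeaningLeaf_of_insert hp hT

theorem GrowsTo.ssubset {T T' : BinaryTree Unit} (h : GrowsTo T T') :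
    (toPlane T).verts ⊂ (toPlane T').verts := by
  obtain ⟨p, hp, hT⟩ := h.exists_insert
  rw [show (toPlane T').verts = _ from hT]
  exact Finset.ssubset_insert hp

theorem numChildren_one_cons (l r : BinaryTree Unit) (u : List ℕ+) :
    (toPlane (l △ r)).numChildren (1 :: u) = (toPlane l).numChildren u := by
  simp only [numChildren, toPlane, List.cons_append, one_cons_mem_planeVerts_node]

theorem numChildren_succ_cons (l r : BinaryTree Unit) (i : ℕ+) (u : List ℕ+) :
    (toPlane (l △ r)).numChildren ((i + 1) :: u) = (toPlane r).numChildren (i :: u) := by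
  simp only [numChildren, toPlane, List.cons_append, succ_cons_mem_planeVerts_node]

theorem finite_children (T : PlaneTree) (u : List ℕ+) : {i : ℕ+ | u ++ [i] ∈ T.verts}.Finite :=
  Set.Finite.preimage (f := fun i : ℕ+ => u ++ [i]) (fun i _ j _ h => by simpa using h)
    T.verts.finite_toSet

theorem numChildren_nil (l r : BinaryTree Unit) :
    (toPlane (l △ r)).numChildren [] = (toPlane r).numChildren [] + 1 := by
  have : {i : ℕ+ | [] ++ [i] ∈ (toPlane (l △ r)).verts} =
      insert 1 ((fun i : ℕ+ => i + 1) '' {i : ℕ+ | [] ++ [i] ∈ (toPlane r).verts}) := by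
    ext i
    simp only [List.nil_append, Set.mem_ofPred_eq, Set.mem_insert_iff, Set.mem_image]
    induction i using PNat.recOn with
    | one => exact ⟨fun _ => Or.inl rfl, fun _ =>
        (one_cons_mem_planeVerts_node l r []).2 (nil_mem_planeVerts l)⟩
    | succ i _ =>
      rw [show [i + 1] ∈ (toPlane (l △ r)).verts ↔ [i] ∈ (toPlane r).verts from
        succ_cons_mem_planeVerts_node l r i []]
      constructor
      · exact fun h => Or.inr ⟨i, h, rfl⟩
      · rintro (h | ⟨k, hk, h⟩)
        · exact absurd h.symm (pnat_one_ne_add_one i)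
        · rw [add_left_inj] at h; exact h ▸ hk
  rw [numChildren, this, Set.ncard_insert_of_notMem _ ((finite_children _ _).image _),
    Set.ncard_image_of_injective, numChildren]
  · exact fun i j h => by simpa using h
  · rintro ⟨k, _, h⟩; exact pnat_one_ne_add_one k h.symm

/-- Only the root feels the shift: putting back a first subtree adds one to its degree, which turns
the shift `j + 1` of the remainder into `j`. -/
theorem planeWeight_eq (w : ℕ → ℝ) (T : BinaryTree Unit) : ∀ j, planeWeight w j T =
    w (j + (toPlane T).numChildren []) *
      ∏ u ∈ (planeVerts T).erase [], w ((toPlane T).numChildren u) := by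
  induction T with
  | nil => intro j; simp [planeWeight, planeVerts, numChildren, toPlane]
  | node a l r ihl ihr =>
    cases a
    intro j
    have hl : planeWeight w 0 l = ∏ u ∈ planeVerts l, w ((toPlane l).numChildren u) := by
      rw [ihl, zero_add]
      exact Finset.mul_prod_erase (planeVerts l) (fun u => w ((toPlane l).numChildren u))
        (nil_mem_planeVerts l)
    have he : (planeVerts (l △ r)).erase [] = (planeVerts l).map ⟨_, cons_one_injective⟩ ∪
        ((planeVerts r).erase []).map ⟨_, bump_injective⟩ := by
      rw [Finset.map_erase, planeVerts, Finset.erase_union_distrib, Finset.erase_eq_of_notMem]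
      · rfl
      · simp
    rw [planeWeight, hl, ihr, he, Finset.prod_union, Finset.prod_map, Finset.prod_map,
      numChildren_nil]
    · simp only [Function.Embedding.coeFn_mk, numChildren_one_cons]
      have : ∀ u ∈ (planeVerts r).erase [], w ((toPlane (l △ r)).numChildren (bump u)) =
          w ((toPlane r).numChildren u) := by
        rintro (_ | ⟨i, u⟩) hu
        · simp at hu
        · rw [bump, numChildren_succ_cons]
      rw [Finset.prod_congr rfl this, show j + ((toPlane r).numChildren [] + 1) =
        j + 1 + (toPlane r).numChildren [] by ring]
      ring
    · exact (disjoint_planeVerts l r).mono_right (Finset.map_subset_map.2 (Finset.erase_subset _ _))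

theorem weight_toPlane (w : ℕ → ℝ) (T : BinaryTree Unit) :
    (toPlane T).weight w = planeWeight w 0 T := by
  rw [planeWeight_eq, zero_add]
  exact (Finset.mul_prod_erase (planeVerts T) (fun u => w ((toPlane T).numChildren u))
    (nil_mem_planeVerts T)).symm

theorem planeVerts_injective : Function.Injective planeVerts := by
  intro T
  induction T with
  | nil =>
    rintro (_ | ⟨_, l, r⟩) h
    · rfl
    · have := (one_cons_mem_planeVerts_node l r []).2 (nil_mem_planeVerts l)
      rw [← h] at this
      simp [planeVerts] at this
  | node a l r ihl ihr =>
    rintro (_ | ⟨_, l', r'⟩) h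
    · have := (one_cons_mem_planeVerts_node l r []).2 (nil_mem_planeVerts l)
      rw [show planeVerts (l △ r) = _ from h] at this
      simp [planeVerts] at this
    · rw [ihl (a₂ := l'), ihr (a₂ := r')]
      · ext u
        rcases u with _ | ⟨i, u⟩
        · simp [nil_mem_planeVerts]
        · rw [← succ_cons_mem_planeVerts_node l r, ← succ_cons_mem_planeVerts_node l' r']
          exact h ▸ Iff.rfl
      · ext u
        rw [← one_cons_mem_planeVerts_node l r, ← one_cons_mem_planeVerts_node l' r']
        exact h ▸ Iff.rfl

/-- If the root has a child, the tree is cut into first subtree and remainder. Both are smaller: the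
embedding of the first misses `[]`, that of the second misses `[1]`. -/
theorem exists_planeVerts_eq (n : ℕ) : ∀ P : PlaneTree, P.verts.card = n →
    ∃ T, planeVerts T = P.verts := by
  induction n using Nat.strong_induction_on with
  | _ n ih =>
    intro P hP
    by_cases h1 : [1] ∈ P.verts
    · let L : PlaneTree :=
        { verts := P.verts.preimage _ cons_one_injective.injOn
          nonempty := ⟨[], by simpa using h1⟩
          parent_mem := fun u i h => by
            simp only [Finset.mem_preimage] at h ⊢
            exact P.parent_mem (1 :: u) i h
          left_mem := fun u i j h hij => by
            simp only [Finset.mem_preimage] at h ⊢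
            exact P.left_mem (1 :: u) i j h hij }
      let R : PlaneTree :=
        { verts := P.verts.preimage _ bump_injective.injOn
          nonempty := ⟨[], by simpa [bump] using P.nil_mem⟩
          parent_mem := fun u i h => by
            simp only [Finset.mem_preimage] at h ⊢
            rcases u with _ | ⟨k, u⟩
            · exact P.nil_mem
            · exact P.parent_mem ((k + 1) :: u) i h
          left_mem := fun u i j h hij => by
            simp only [Finset.mem_preimage] at h ⊢
            rcases u with _ | ⟨k, u⟩
            · exact P.left_mem [] (i + 1) (j + 1) h (by simpa using hij)
            · exact P.left_mem ((k + 1) :: u) i j h hij }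
      have hL : L.verts.card < n := by
        rw [← hP, ← Finset.card_map ⟨_, cons_one_injective⟩]
        refine Finset.card_lt_card ⟨fun u hu => ?_, fun h => ?_⟩
        · obtain ⟨v, hv, rfl⟩ := Finset.mem_map.1 hu
          exact (Finset.mem_preimage (hf := cons_one_injective.injOn)).1 hv
        · obtain ⟨v, _, hv⟩ := Finset.mem_map.1 (h P.nil_mem)
          simp at hv
      have hR : R.verts.card < n := by
        rw [← hP, ← Finset.card_map ⟨_, bump_injective⟩]
        refine Finset.card_lt_card ⟨fun u hu => ?_, fun h => ?_⟩
        · obtain ⟨v, hv, rfl⟩ := Finset.mem_map.1 hu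
          exact (Finset.mem_preimage (hf := bump_injective.injOn)).1 hv
        · obtain ⟨v, _, hv⟩ := Finset.mem_map.1 (h h1)
          rcases v with _ | ⟨i, v⟩
          · simp [bump] at hv
          · simp only [Function.Embedding.coeFn_mk, bump, List.cons.injEq] at hv
            exact pnat_one_ne_add_one i hv.1.symm
      obtain ⟨l, hl⟩ := ih _ hL L rfl
      obtain ⟨r, hr⟩ := ih _ hR R rfl
      refine ⟨l △ r, ?_⟩
      ext u
      induction u using word_cases with
      | nil => simp [nil_mem_planeVerts, P.nil_mem]
      | one u =>
        rw [one_cons_mem_planeVerts_node, hl]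
        exact Finset.mem_preimage (hf := cons_one_injective.injOn)
      | bump i u =>
        rw [succ_cons_mem_planeVerts_node, hr]
        exact Finset.mem_preimage (hf := bump_injective.injOn)
    · refine ⟨nil, ?_⟩
      ext u
      simp only [planeVerts, Finset.mem_singleton]
      constructor
      · rintro rfl; exact P.nil_mem
      · intro hu
        rcases u with _ | ⟨i, u⟩
        · rfl
        · exact absurd (P.left_mem [] i 1 (P.mem_of_append_mem [i] u hu) (one_le)) h1

/-- Binary trees encode plane trees. -/
noncomputable def planeEquiv : BinaryTree Unit ≃ PlaneTree :=
  Equiv.ofBijective toPlane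
    ⟨fun _ _ h => planeVerts_injective (congrArg PlaneTree.verts h), fun P => by
      obtain ⟨T, hT⟩ := exists_planeVerts_eq _ P rfl
      exact ⟨T, PlaneTree.ext hT⟩⟩

theorem planeEquiv_apply (T : BinaryTree Unit) : planeEquiv T = toPlane T := rfl

end BinaryTree

/-! ### A Markov chain driven by an independent choice of a successor of each state -/

namespace SuccessorChain

variable {S : Type} {G : S → S → Prop}

/-- The chain which follows the chosen successors. -/
def chain (s₀ : S) (ω : ∀ a, {b // G a b}) : ℕ → S
  | 0 => s₀
  | n + 1 => ω (chain s₀ ω n)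

theorem size_chain {size : S → ℕ} (hG : ∀ a b, G a b → size b = size a + 1) {s₀ : S}
    (h₀ : size s₀ = 0) (ω : ∀ a, {b // G a b}) (n : ℕ) : size (chain s₀ ω n) = n := by
  induction n with
  | zero => exact h₀
  | succ n ih => rw [chain, hG _ _ (ω _).2, ih]

variable [MeasurableSpace S]

/-- The σ-algebra generated by the successors of the states of size less than `n`. -/
@[reducible]
def past (G : S → S → Prop) (size : S → ℕ) (n : ℕ) : MeasurableSpace (∀ a, {b // G a b}) :=
  ⨆ a ∈ {a | size a < n}, MeasurableSpace.comap (fun ω : ∀ a, {b // G a b} => ω a) inferInstance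

theorem past_le (size : S → ℕ) (n : ℕ) : past G size n ≤ MeasurableSpace.pi :=
  iSup₂_le fun a _ => (measurable_pi_apply a).comap_le

variable [DiscreteMeasurableSpace S] {size : S → ℕ} {s₀ : S}

/-- The state at time `i` has size `i`, so up to time `n` the chain consults only successors of
states of size less than `n`. -/
theorem measurableSet_past [Countable S] (hG : ∀ a b, G a b → size b = size a + 1) (h₀ : size s₀ = 0)
    {i n : ℕ} (hi : i ≤ n) (x : S) :
    MeasurableSet[past G size n] {ω | chain s₀ ω i = x} := by
  induction i generalizing x with
  | zero => exact @MeasurableSet.const _ (past G size n) (s₀ = x)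
  | succ i ih =>
    have e : {ω : ∀ a, {b // G a b} | chain s₀ ω (i + 1) = x} =
        ⋃ a : S, ⋃ _ : size a = i, {ω | chain s₀ ω i = a} ∩ {ω | (ω a : S) = x} := by
      ext ω
      simp only [Set.mem_ofPred_eq, Set.mem_iUnion, Set.mem_inter_iff, exists_prop]
      constructor
      · intro h
        exact ⟨chain s₀ ω i, size_chain hG h₀ ω i, rfl, h⟩
      · rintro ⟨a, _, rfl, h⟩
        exact h
    rw [e]
    refine MeasurableSet.iUnion fun a => MeasurableSet.iUnion fun ha => ?_
    refine MeasurableSet.inter (ih (by omega) a) ?_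
    have h1 : MeasurableSpace.comap (fun ω : ∀ a, {b // G a b} => ω a) inferInstance ≤
        past G size n :=
      le_iSup₂_of_le a (show size a < n by omega) le_rfl
    exact h1 _ ⟨{y | (y : S) = x}, measurable_subtype_coe (MeasurableSet.of_discrete (s := {x})), rfl⟩

variable (κ : ∀ a, Measure {b // G a b}) [∀ a, IsProbabilityMeasure (κ a)]

theorem measure_successor (a b : S) :
    Measure.infinitePi κ {ω | (ω a : S) = b} = κ a {y | (y : S) = b} := by
  rw [← Measure.infinitePi_map_eval κ a, Measure.map_apply (measurable_pi_apply a)]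
  · rfl
  · exact measurable_subtype_coe (MeasurableSet.of_discrete (s := {b}))

/-- A state of size `n` is not among those generating the past, so its successor is independent of
it. -/
theorem measure_past_inter {n : ℕ} {A : Set (∀ a, {b // G a b})}
    (hA : MeasurableSet[past G size n] A) {a : S} (ha : size a = n) (b : S) :
    Measure.infinitePi κ (A ∩ {ω | (ω a : S) = b}) =
      Measure.infinitePi κ A * κ a {y | (y : S) = b} := by
  rw [← measure_successor]
  have h := ProbabilityTheory.iIndepFun_infinitePi (P := κ) (X := fun _ y => y)
    (fun _ => measurable_id)
  rw [ProbabilityTheory.iIndepFun_iff_iIndep] at h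
  have h2 := ProbabilityTheory.indep_iSup_of_disjoint (fun a => (measurable_pi_apply a).comap_le) h
    (S := {a | size a < n}) (T := {a}) (by simp [ha])
  rw [ProbabilityTheory.Indep_iff] at h2
  refine h2 _ _ hA ?_
  rw [iSup_singleton]
  exact ⟨{y | (y : S) = b}, measurable_subtype_coe (MeasurableSet.of_discrete (s := {b})), rfl⟩

/-- The answer depends on `A` only through `a`. Applied to the whole history and to the present
alone, it gives the Markov property. -/
theorem cond_past [Countable S] (hG : ∀ a b, G a b → size b = size a + 1) (h₀ : size s₀ = 0)
    {n : ℕ} {A : Set (∀ a, {b // G a b})} (hA : MeasurableSet[past G size n] A)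
    {a : S} (hAa : ∀ ω ∈ A, chain s₀ ω n = a) (hpos : Measure.infinitePi κ A ≠ 0) (b : S) :
    ProbabilityTheory.cond (Measure.infinitePi κ) A {ω | chain s₀ ω (n + 1) = b} =
      κ a {y | (y : S) = b} := by
  obtain ⟨ω, hω⟩ := nonempty_of_measure_ne_zero hpos
  have ha : size a = n := by rw [← hAa ω hω]; exact size_chain hG h₀ ω n
  have e : A ∩ {ω | chain s₀ ω (n + 1) = b} = A ∩ {ω | (ω a : S) = b} := by
    ext ω
    simp only [Set.mem_inter_iff, Set.mem_ofPred_eq, and_congr_right_iff, chain]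
    intro h
    rw [hAa ω h]
  rw [ProbabilityTheory.cond_apply (past_le size n _ hA), e, measure_past_inter κ hA ha,
    ← mul_assoc, ENNReal.inv_mul_cancel hpos (measure_ne_top _ _), one_mul]

theorem measure_chain_succ [Countable S] (hG : ∀ a b, G a b → size b = size a + 1) (h₀ : size s₀ = 0)
    {n : ℕ} {B : Finset S} (hB : ∀ a, a ∈ B ↔ size a = n) (b : S) :
    Measure.infinitePi κ {ω | chain s₀ ω (n + 1) = b} =
      ∑ a ∈ B, Measure.infinitePi κ {ω | chain s₀ ω n = a} * κ a {y | (y : S) = b} := by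
  have e : {ω : ∀ a, {b // G a b} | chain s₀ ω (n + 1) = b} =
      ⋃ a ∈ B, {ω | chain s₀ ω n = a} ∩ {ω | (ω a : S) = b} := by
    ext ω
    simp only [Set.mem_ofPred_eq, Set.mem_iUnion, Set.mem_inter_iff, exists_prop]
    constructor
    · intro h
      exact ⟨chain s₀ ω n, (hB _).2 (size_chain hG h₀ ω n), rfl, h⟩
    · rintro ⟨a, _, rfl, h⟩
      exact h
  rw [e, measure_biUnion_finset]
  · refine Finset.sum_congr rfl fun a ha => ?_
    exact measure_past_inter κ (measurableSet_past hG h₀ le_rfl a) ((hB a).1 ha) b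
  · intro a _ a' _ hne
    rw [Function.onFun, Set.disjoint_left]
    rintro ω ⟨h1, _⟩ ⟨h2, _⟩
    exact hne (Eq.trans (Eq.symm h1) h2)
  · intro a _
    exact (past_le size n _ (measurableSet_past hG h₀ le_rfl a)).inter
      ((measurable_subtype_coe.comp (measurable_pi_apply a))
        (MeasurableSet.of_discrete (s := {b})))

end SuccessorChain

/-! ### Laws of simply generated trees and the final coupling. -/

namespace PlaneTree

instance : Countable PlaneTree :=
  Function.Injective.countable (f := PlaneTree.verts) fun _ _ h => PlaneTree.ext h

instance : DiscreteMeasurableSpace PlaneTree := ⟨fun _ => trivial⟩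

theorem weightMeasure_singleton (w : ℕ → ℝ) (T : PlaneTree) :
    weightMeasure w {T} = ENNReal.ofReal (weight w T) := by
  rw [weightMeasure, Measure.sum_apply _ (measurableSet_singleton T), tsum_eq_single T]
  · simp
  · intro T' h
    simp [h]

theorem weightMeasure_ofSize {w : ℕ → ℝ} (hw : ∀ i, 0 ≤ w i) (n : ℕ) :
    weightMeasure w (ofSize (n + 1)) = ENNReal.ofReal (treeWeight w 0 n) := by
  have e : ofSize (n + 1) =
      ((BinaryTree.treesOfNumNodesEq n).map BinaryTree.planeEquiv.toEmbedding : Finset PlaneTree) := by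
    ext P
    obtain ⟨T, rfl⟩ := BinaryTree.planeEquiv.surjective P
    rw [Finset.mem_coe, Finset.mem_map_equiv, Equiv.symm_apply_apply,
      BinaryTree.mem_treesOfNumNodesEq]
    simp [ofSize, BinaryTree.planeEquiv_apply, BinaryTree.toPlane, BinaryTree.card_planeVerts]
  rw [e, ← sum_measure_singleton, Finset.sum_map, ← BinaryTree.sum_planeWeight,
    ENNReal.ofReal_sum_of_nonneg fun T _ => BinaryTree.planeWeight_nonneg hw T 0]
  refine Finset.sum_congr rfl fun T _ => ?_
  rw [weightMeasure_singleton, ← BinaryTree.weight_toPlane]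
  rfl

theorem SG_singleton {w : ℕ → ℝ} (hw : ∀ i, 0 ≤ w i) (hw0 : 0 < w 0) (hw1 : 0 < w 1) (n : ℕ)
    (T : BinaryTree Unit) : SG w (n + 1) {T.toPlane} =
      if T.numNodes = n then ENNReal.ofReal (T.planeWeight w 0 / treeWeight w 0 n) else 0 := by
  rw [SG, ProbabilityTheory.cond_apply MeasurableSet.of_discrete, weightMeasure_ofSize hw]
  have hmem : T.toPlane ∈ ofSize (n + 1) ↔ T.numNodes = n := by
    simp [ofSize, BinaryTree.toPlane, BinaryTree.card_planeVerts]
  split_ifs with h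
  · rw [Set.inter_eq_right.2 (by simpa using hmem.2 h), weightMeasure_singleton,
      BinaryTree.weight_toPlane,
      ENNReal.ofReal_div_of_pos (BinaryTree.treeWeight_zero_pos hw hw0 hw1 n), mul_comm,
      ENNReal.div_eq_inv_mul, mul_comm]
  · rw [Set.inter_singleton_eq_empty.2 (fun hc => h (hmem.1 hc))]; simp

end PlaneTree

namespace BinaryTree

instance : Countable (BinaryTree Unit) := planeEquiv.injective.countable

/-- The discrete σ-algebra on binary trees. -/
instance : MeasurableSpace (BinaryTree Unit) := ⊤

instance : DiscreteMeasurableSpace (BinaryTree Unit) := ⟨fun _ => trivial⟩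

/-- The law of the successor of a tree under a growth flow. -/
theorem IsGrowthFlow.exists_law {w : ℕ → ℝ} (hw : ∀ i, 0 ≤ w i) (hw0 : 0 < w 0) (hw1 : 0 < w 1)
    {N : ℕ} {φ : BinaryTree Unit → BinaryTree Unit → ℝ} (hφ : IsGrowthFlow w 0 N φ)
    {T : BinaryTree Unit} (hT : T.numNodes = N) :
    ∃ κ : Measure {T' // GrowsTo T T'}, IsProbabilityMeasure κ ∧
      (planeWeight w 0 T ≠ 0 → ∀ T', κ {y | (y : BinaryTree Unit) = T'} =
        ENNReal.ofReal (φ T T' / (planeWeight w 0 T * treeWeight w 0 (N + 1)))) := by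
  by_cases h0 : planeWeight w 0 T = 0
  -- A tree of zero weight is visited with probability zero; any successor will do.
  · obtain ⟨T', hT'⟩ := exists_growsTo T
    exact ⟨Measure.dirac ⟨T', hT'⟩, inferInstance, fun h => absurd h0 h⟩
  set D := planeWeight w 0 T * treeWeight w 0 (N + 1) with hD
  have hDpos : 0 < D := mul_pos (lt_of_le_of_ne (planeWeight_nonneg hw _ _) (Ne.symm h0))
    (treeWeight_zero_pos hw hw0 hw1 _)
  let f : BinaryTree Unit → ENNReal := fun T' => ENNReal.ofReal (φ T T' / D)
  have hf : ∀ T', f T' ≠ 0 → GrowsTo T T' := by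
    intro T' h
    refine hφ.growsTo T T' fun hc => h ?_
    simp [f, hc]
  have hsum : ∑' y : {T' // GrowsTo T T'}, f y = 1 := by
    refine (tsum_subtype_eq_of_support_subset (s := {T' | GrowsTo T T'})
      (fun T' h => hf T' h)).trans ?_
    rw [tsum_eq_sum (s := treesOfNumNodesEq (N + 1))]
    · rw [← ENNReal.ofReal_sum_of_nonneg fun T' _ => div_nonneg (hφ.nonneg _ _) hDpos.le,
        ← Finset.sum_div, hφ.sum_right T (by simp [hT]), ← hD, div_self hDpos.ne',
        ENNReal.ofReal_one]
    · intro T' h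
      by_contra hc
      exact h (by rw [mem_treesOfNumNodesEq, (hf T' hc).numNodes_eq, hT])
  let p : PMF {T' // GrowsTo T T'} := ⟨fun y => f y, by
    rw [← hsum]; exact ENNReal.summable.hasSum⟩
  refine ⟨p.toMeasure, inferInstance, fun _ T' => ?_⟩
  by_cases hg : GrowsTo T T'
  · have e : {y : {T' // GrowsTo T T'} | (y : BinaryTree Unit) = T'} = {⟨T', hg⟩} := by
      ext y; simp [Subtype.ext_iff]
    rw [e, PMF.toMeasure_apply_singleton _ _ (measurableSet_singleton _)]
    rfl
  · have e : {y : {T' // GrowsTo T T'} | (y : BinaryTree Unit) = T'} = ∅ := by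
      ext y
      simp only [Set.mem_ofPred_eq, Set.mem_empty_iff_false, iff_false]
      rintro rfl
      exact hg y.2
    rw [e, measure_empty]
    by_contra hc
    exact hg (hf T' (Ne.symm hc))

end BinaryTree

open BinaryTree SuccessorChain in
theorem hasIncreasingMarkovCoupling_SG {w : ℕ → ℝ} (hw : ∀ i, 0 ≤ w i) (hw01 : 0 < w 0 * w 1)
    (hlc : IsLogConcave w) : HasIncreasingMarkovCoupling (PlaneTree.SG w) := by
  have hw0 : 0 < w 0 := lt_of_le_of_ne (hw 0) fun h => by simp [← h] at hw01
  have hw1 : 0 < w 1 := lt_of_le_of_ne (hw 1) fun h => by simp [← h] at hw01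
  choose φ hφ using fun N => exists_isGrowthFlow hlc hw hw0 hw1 N 0
  choose κ hκ hκφ using fun T : BinaryTree Unit => (hφ T.numNodes).exists_law hw hw0 hw1 rfl
  have hG : ∀ a b : BinaryTree Unit, GrowsTo a b → b.numNodes = a.numNodes + 1 :=
    fun _ _ h => h.numNodes_eq
  have h₀ : (nil : BinaryTree Unit).numNodes = 0 := rfl
  let P := Measure.infinitePi κ
  let X : ℕ → (∀ a, {b // GrowsTo a b}) → BinaryTree Unit := fun n ω => chain nil ω n
  have hmeas : ∀ n, Measurable (X n) := fun n => measurable_to_countable' fun x =>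
    past_le _ _ _ (measurableSet_past hG h₀ (le_refl n) x)
  have hpos := treeWeight_zero_pos hw hw0 hw1
  have hlaw : ∀ n T, P {ω | X n ω = T} =
      if T.numNodes = n then ENNReal.ofReal (planeWeight w 0 T / treeWeight w 0 n) else 0 := by
    intro n
    induction n with
    | zero =>
      intro T
      rcases T with _ | ⟨a, l, r⟩
      · simp [X, chain, planeWeight, treeWeight_zero, div_self hw0.ne', P]
      · simp [X, chain]
    | succ n ih =>
      intro T
      split_ifs with hT
      · have h1 := measure_chain_succ κ hG h₀ (B := treesOfNumNodesEq n)
          (fun a => mem_treesOfNumNodesEq) T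
        have h2 : ∀ a ∈ treesOfNumNodesEq n, P {ω | X n ω = a} *
            κ a {y | (y : BinaryTree Unit) = T} =
            ENNReal.ofReal (φ n a T / (treeWeight w 0 n * treeWeight w 0 (n + 1))) := by
          intro a ha
          have han := mem_treesOfNumNodesEq.1 ha
          rw [ih, if_pos han]
          -- The flow out of a tree of zero weight is zero, so its arbitrary successor law plays no
          -- role.
          by_cases hWa : planeWeight w 0 a = 0
          · have h3 := (hφ n).sum_right a ha
            rw [hWa, zero_mul, Finset.sum_eq_zero_iff_of_nonneg fun T' _ => (hφ n).nonneg a T'] at h3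
            rw [hWa, h3 T (by simp [hT])]
            simp
          · rw [hκφ a hWa, han, ← ENNReal.ofReal_mul
              (div_nonneg (planeWeight_nonneg hw _ _) (hpos n).le)]
            congr 1
            have := (hpos n).ne'
            have := (hpos (n + 1)).ne'
            field_simp
        refine h1.trans ?_
        rw [Finset.sum_congr rfl h2, ← ENNReal.ofReal_sum_of_nonneg fun a _ =>
          div_nonneg ((hφ n).nonneg a T) (mul_pos (hpos n) (hpos (n + 1))).le, ← Finset.sum_div,
          (hφ n).sum_left T (by simp [hT])]
        congr 1
        have := (hpos n).ne'
        have := (hpos (n + 1)).ne'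
        field_simp
      · have : {ω | X (n + 1) ω = T} = ∅ := by
          ext ω
          simp only [Set.mem_ofPred_eq, Set.mem_empty_iff_false, iff_false]
          rintro rfl
          exact hT (size_chain hG h₀ ω (n + 1))
        rw [this, measure_empty]
  -- Successors are drawn from subtypes, so growth holds for every `ω` and not just almost surely.
  -- Time is shifted since `n` vertices correspond to `n - 1` binary nodes.
  refine ⟨∀ a : BinaryTree Unit, {b // GrowsTo a b}, inferInstance, P,
    fun n ω => toPlane (X (n - 1) ω), inferInstance, fun n hn => ?_, ?_, fun ω n hn => ?_,
    fun ω n hn => ?_⟩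
  · have hm : Measurable fun ω => toPlane (X (n - 1) ω) := 
      (Measurable.of_discrete (f := toPlane)).comp (hmeas (n - 1))
    refine ⟨hm, Measure.ext_of_singleton fun t => ?_⟩
    obtain ⟨n, rfl⟩ := Nat.exists_eq_add_of_le' hn
    obtain ⟨T, rfl⟩ := planeEquiv.surjective t
    rw [Measure.map_apply hm (measurableSet_singleton _), planeEquiv_apply,
      PlaneTree.SG_singleton hw hw0 hw1, ← hlaw]
    congr 1
    ext ω
    exact planeEquiv.injective.eq_iff
  · intro n hn x y hne
    obtain ⟨n, rfl⟩ := Nat.exists_eq_add_of_le' hn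
    have key : ∀ i, ∀ t : PlaneTree, {ω | toPlane (X i ω) = t} =
        {ω | X i ω = planeEquiv.symm t} := by
      intro i t
      ext ω
      exact (Equiv.eq_symm_apply planeEquiv).symm
    simp only [Nat.add_sub_cancel]
    have hE : {ω | ∀ i ∈ Finset.Icc 1 (n + 1), toPlane (X (i - 1) ω) = x i} =
        ⋂ i ∈ Finset.Icc 1 (n + 1), {ω | X (i - 1) ω = planeEquiv.symm (x i)} := by
      ext ω
      simp only [Set.mem_ofPred_eq, Set.mem_iInter]
      exact forall₂_congr fun i _ => (Equiv.eq_symm_apply planeEquiv).symm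
    have hsub : {ω | ∀ i ∈ Finset.Icc 1 (n + 1), toPlane (X (i - 1) ω) = x i} ⊆
        {ω | X n ω = planeEquiv.symm (x (n + 1))} := by
      rw [← key]
      exact fun ω h => h (n + 1) (by simp)
    rw [key, key]
    have h1 := cond_past κ hG h₀ (n := n) (a := planeEquiv.symm (x (n + 1)))
      (A := {ω | ∀ i ∈ Finset.Icc 1 (n + 1), toPlane (X (i - 1) ω) = x i}) (by
        rw [hE]
        refine Finset.measurableSet_biInter _ fun i hi => ?_
        exact measurableSet_past hG h₀ (by simp at hi; omega) _) (fun ω h => hsub h) hne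
      (planeEquiv.symm y)
    have h2 := cond_past κ hG h₀ (n := n) (a := planeEquiv.symm (x (n + 1)))
      (measurableSet_past hG h₀ le_rfl _) (fun ω h => h)
      (fun h => hne (measure_mono_null hsub h)) (planeEquiv.symm y)
    exact h1.trans h2.symm
  · obtain ⟨n, rfl⟩ := Nat.exists_eq_add_of_le' hn
    exact GrowsTo.ssubset (ω (X n ω)).2
  · obtain ⟨n, rfl⟩ := Nat.exists_eq_add_of_le' hn
    exact GrowsTo.addsRightLeaningLeaf (ω (X n ω)).2

theorem theorem1 :
    (∀ (μ : Measure ℕ) [IsProbabilityMeasure μ],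
      0 < μ.real {0} → μ.real {0} < 1 → IsLogConcave (fun k => μ.real {k}) →
      HasIncreasingMarkovCoupling (PlaneTree.condBGW μ)) ∧
    (∀ w : ℕ → ℝ,
      (∀ i, 0 ≤ w i) → 0 < w 0 * w 1 → IsLogConcave w →
      HasIncreasingMarkovCoupling (PlaneTree.SG w)) := by
  refine ⟨fun μ _ h0 h1 hlc => ?_, fun w hw hw01 hlc => hasIncreasingMarkovCoupling_SG hw hw01 hlc⟩
  refine hasIncreasingMarkovCoupling_SG (w := fun k => μ.real {k}) (fun _ => measureReal_nonneg)
    (mul_pos h0 (lt_of_le_of_ne measureReal_nonneg fun hμ1 => h1.ne ?_)) hlc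
  -- If `μ {1}` were zero, the absence of internal zeros would put all the mass at `0`, against
  -- `μ.real {0} < 1`.
  have hz : ∀ k, k ≠ 0 → μ {k} = 0 := by
    intro k hk
    by_contra hne
    have hk' : μ.real {k} ≠ 0 := by
      rw [Measure.real, ENNReal.toReal_ne_zero]; exact ⟨hne, measure_ne_top _ _⟩
    exact hlc.no_internal_zeros 0 k 1 (by omega) (by omega) h0.ne' hk' hμ1.symm
  have hc : μ {0}ᶜ = 0 := by
    rw [← Set.biUnion_of_singleton ({0}ᶜ : Set ℕ), measure_biUnion_null_iff (Set.to_countable _)]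
    exact fun k hk => hz k hk
  have := measureReal_add_measureReal_compl (μ := μ) (measurableSet_singleton 0)
  rw [measureReal_def μ {0}ᶜ, hc] at this
  simpa using this
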